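/- Let $n\ge 1$ and let $K, L\subset\mathbb{R}^n$ be origin-symmetric convex bodies (compact convex sets with non-empty interior, $-K=K$, $-L=L$) in John's position, i.e. the ellipsoid of maximal volume contained in each of them is the Euclidean unit ball $B_2^n$. Write $|\cdot|$ for Lebesgue measure of the appropriate dimension, and $|L|\theta^\perp|$ for the $(n-1)$-dimensional volume of the orthogonal projection of $L$ onto the hyperplane $\theta^\perp$. (a) If $|K\cap\theta^{\perp}|\le |L|\theta^{\perp}|$ for all $\theta\in S^{n-1}$, then $$|K|\le \sqrt{n}\,|L|.$$ (b) Let $n\ge 2$ and let $\mu$ be an arbitrary absolutely continuous measure on $\mathbb{R}^n$ with continuous density $g:\mathbb{R}^n\to[0,\infty)$. Put $$\mu_{n-1}(K\cap\theta^\perp)=\int_{K\cap\theta^\perp} g(x)\,d\lambda_{n-1}(x),$$ where $\lambda_{n-1}$ is Lebesgue measure on $\theta^\perp$, and $$P_{\mu,L}(\theta)=\frac n2\int_0^1\mu_1(tL,[-\theta,\theta])\,dt,\qquad \mu_1(A,B)=\liminf_{\varepsilon\to0^+}\frac{\mu(A+\varepsilon B)-\mu(A)}{\varepsilon}.$$ If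 $\mu_{n-1}(K\cap\theta^{\perp})\le P_{\mu,L}(\theta)$ for all $\theta\in S^{n-1}$, then $$\mu(K)\le \frac{\sqrt{n}}{1-\frac1n}\,\mu(L).$$ -/

import Mathlib

open MeasureTheory Metric Set Filter Topology
open scoped ENNReal NNReal Pointwise RealInnerProductSpace

noncomputable section

/-- Euclidean space `ℝⁿ`. -/
abbrev Rn (n : ℕ) : Type := EuclideanSpace ℝ (Fin n)

/-- A convex body: a compact convex set with non-empty interior. -/
structure IsConvexBody {n : ℕ} (K : Set (Rn n)) : Prop where
  convex : Convex ℝ K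
  isCompact : IsCompact K
  interior_nonempty : (interior K).Nonempty

/-- Symmetry about the origin, `-K = K`. -/
def IsOriginSymmetric {n : ℕ} (K : Set (Rn n)) : Prop := -K = K

/-- An ellipsoid with non-empty interior: the image of the closed unit ball under an invertible
affine map `x ↦ T x + a`. The centre `a` is arbitrary. -/
def IsEllipsoid {n : ℕ} (S : Set (Rn n)) : Prop :=
  ∃ (T : Rn n ≃ₗ[ℝ] Rn n) (a : Rn n), S = (fun x => T x + a) '' closedBall (0 : Rn n) 1

/-- `S` is an ellipsoid of maximal volume among all ellipsoids contained in `K`. -/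
structure IsMaxVolumeEllipsoid {n : ℕ} (K S : Set (Rn n)) : Prop where
  isEllipsoid : IsEllipsoid S
  subset : S ⊆ K
  volume_le : ∀ S' : Set (Rn n), IsEllipsoid S' → S' ⊆ K → volume S' ≤ volume S

/-- `K` is in John's position: its ellipsoid of maximal volume is the unit ball. -/
def IsJohnPosition {n : ℕ} (K : Set (Rn n)) : Prop :=
  IsMaxVolumeEllipsoid K (closedBall (0 : Rn n) 1)

/-- The hyperplane `θ^⊥` as a linear subspace (for `θ ≠ 0`). -/
abbrev hyperplane {n : ℕ} (θ : Rn n) : Submodule ℝ (Rn n) := (ℝ ∙ θ)ᗮ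

/-- Lebesgue measure on the Euclidean space `θ^⊥`, normalized so that the unit cube spanned by an
orthonormal basis has measure one. The instance is written out because a subspace, as a subtype,
also carries the restriction of the ambient volume, which vanishes on a hyperplane. -/
def hyperplaneVolume {n : ℕ} (θ : Rn n) : Measure (hyperplane θ) :=
  (measureSpaceOfInnerProductSpace (E := hyperplane θ)).volume

/-- `|K ∩ θ^⊥|`, the `(n-1)`-dimensional volume of the central section. -/
def sectionVolume {n : ℕ} (K : Set (Rn n)) (θ : Rn n) : ℝ≥0∞ :=
  hyperplaneVolume θ {x | (x : Rn n) ∈ K}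

/-- `|K|θ^⊥|`, the `(n-1)`-dimensional volume of the orthogonal projection of `K` onto `θ^⊥`. -/
def projectionVolume {n : ℕ} (K : Set (Rn n)) (θ : Rn n) : ℝ≥0∞ :=
  hyperplaneVolume θ ((fun x => (hyperplane θ).orthogonalProjectionOnto x) '' K)

/-- `μ_{n-1}(K ∩ θ^⊥)` for the measure `μ` with density `g`: the integral of `g` over the section
with respect to `(n-1)`-dimensional Lebesgue measure. -/
def sectionMeasure {n : ℕ} (g : Rn n → ℝ≥0) (K : Set (Rn n)) (θ : Rn n) : ℝ≥0∞ :=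
  ∫⁻ x in {x : hyperplane θ | (x : Rn n) ∈ K}, (g x : ℝ≥0∞) ∂(hyperplaneVolume θ)

/-- The mixed `μ`-measure
`μ₁(A, B) = liminf_{ε → 0+} (μ(A + ε B) - μ(A)) / ε`. -/
def mixedMeasure {n : ℕ} (μ : Measure (Rn n)) (A B : Set (Rn n)) : EReal :=
  liminf (fun ε : ℝ => ((μ (A + ε • B) : EReal) - (μ A : EReal)) / (ε : EReal)) (𝓝[>] (0 : ℝ))

/-- The `μ`-projection
`P_{μ,K}(θ) = (n/2) ∫₀¹ μ₁(tK, [-θ, θ]) dt`.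
As `0 ∈ [-θ, θ]`, the mixed measure inside is non-negative whenever `μ (tK)` is finite, so
`EReal.toENNReal` loses nothing. -/
def muProjection {n : ℕ} (μ : Measure (Rn n)) (K : Set (Rn n)) (θ : Rn n) : ℝ≥0∞ :=
  (n : ℝ≥0∞) / 2 *
    ∫⁻ t in Icc (0 : ℝ) 1, (mixedMeasure μ (t • K) (segment ℝ (-θ) θ)).toENNReal

end

noncomputable section

/-! Both parts compare sections of `K` with projections of `L` after averaging over directions.
Polar coordinates are avoided: `θ` is replaced by `y / ‖y‖`, where `y` carries the Gaussian weight
`γ(y) = exp (-π ‖y‖ ^ 2)`, and everything is weighted by `‖y‖⁻¹`.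

On the section side, the `γ`-mass of the slab `|⟪x, y⟫| ≤ ε`, divided by `2ε`, tends to `‖x‖⁻¹`,
while the `μ`-mass of the same slab within `K`, now for fixed `y`, concentrates on `K ∩ y^⊥` and
yields `‖y‖⁻¹ μ_{n-1}(K ∩ y^⊥)`. Fubini gives `∫_K g / ‖x‖ ≤ ∫ γ(y) ‖y‖⁻¹ μ_{n-1}(K ∩ y^⊥) dy`
(`lintegral_div_norm_le_sections`). Only this inequality is needed, so Fatou, reverse Fatou and
upper semicontinuity suffice.

On the projection side, Fubini in `(x, t)` turns the mixed measures of the dilates `tL` into a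
derivative of the gauge `p` of `L`: `P_{μ,L}(θ) ≤ (n/2) ∫_L g |∂_θ p|`
(`lintegral_mixedMeasure_le`). Averaging over `y` uses `∫ γ(y) |⟪v, y⟫| / ‖y‖² dy = 2 ‖v‖ / (n -
1)`, and `|∇p| ≤ 1` because `L` contains the unit ball. Hence the average of `P_{μ,L}` is at most `n
/ (n - 1) · μ(L)` (`lintegral_muProjection_le`).

John's position and symmetry give `K ⊆ √n B`. For (b), `1 ≤ √n / ‖x‖` on `K` finishes the proof. For
(a), the stronger bound `∫_K ‖x‖⁻¹ ≥ n / ((n - 1) √n) · |K|` cancels the factor `n / (n - 1)`, and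
`|L|θ^⊥| ≤ P_{μ,L}(θ)` for Lebesgue measure reduces the hypothesis to the same form. -/

/-! ### Orthogonal splitting of space along a unit vector. -/

theorem LinearIsometry.measurePreserving_add_smul {U E : Type*}
    [NormedAddCommGroup U] [InnerProductSpace ℝ U] [FiniteDimensional ℝ U] [MeasurableSpace U]
    [BorelSpace U] [NormedAddCommGroup E] [InnerProductSpace ℝ E] [FiniteDimensional ℝ E]
    [MeasurableSpace E] [BorelSpace E] (i : U →ₗᵢ[ℝ] E) (θ : E) (hθ : ‖θ‖ = 1)
    (hi : ∀ u, ⟪i u, θ⟫ = 0) (hd : Module.finrank ℝ U + 1 = Module.finrank ℝ E) :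
    MeasurePreserving (fun p : U × ℝ => i p.1 + p.2 • θ) := by
  let f : WithLp 2 (U × ℝ) →ₗ[ℝ] E :=
    (i.toLinearMap.comp (LinearMap.fst ℝ U ℝ) +
      (LinearMap.toSpanSingleton ℝ E θ).comp (LinearMap.snd ℝ U ℝ)).comp
      (WithLp.linearEquiv 2 ℝ (U × ℝ)).toLinearMap
  have hf : ∀ p, f p = i p.fst + p.snd • θ := fun p => rfl
  let F : WithLp 2 (U × ℝ) →ₗᵢ[ℝ] E := ⟨f, fun p => by
    rw [← sq_eq_sq₀ (norm_nonneg _) (norm_nonneg _), hf, WithLp.prod_norm_sq_eq_of_L2,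
      norm_add_sq_real, inner_smul_right, hi, norm_smul, hθ, i.norm_map]
    simp⟩
  have hd' : Module.finrank ℝ (WithLp 2 (U × ℝ)) = Module.finrank ℝ E := by
    rw [← hd, (WithLp.linearEquiv 2 ℝ (U × ℝ)).finrank_eq]; simp
  let e := F.toLinearIsometryEquiv hd'
  exact e.measurePreserving.comp (WithLp.volume_preserving_toLp U ℝ)

theorem finrank_hyperplane {n : ℕ} {θ : Rn n} (hθ : θ ≠ 0) :
    Module.finrank ℝ (hyperplane θ) + 1 = n := by
  have := Submodule.finrank_add_finrank_orthogonal (ℝ ∙ θ)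
  rw [finrank_span_singleton hθ, finrank_euclideanSpace_fin] at this
  rw [add_comm]
  exact this

theorem inner_hyperplane {n : ℕ} {θ : Rn n} (z : hyperplane θ) : ⟪(z : Rn n), θ⟫ = 0 :=
  Submodule.mem_orthogonal_singleton_iff_inner_left.1 z.2

theorem measurePreserving_hyperplane {n : ℕ} {θ : Rn n} (hθ : ‖θ‖ = 1) :
    MeasurePreserving (fun p : hyperplane θ × ℝ => (p.1 : Rn n) + p.2 • θ)
      ((hyperplaneVolume θ).prod volume) volume :=
  (hyperplane θ).subtypeₗᵢ.measurePreserving_add_smul θ hθ inner_hyperplane (by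
    rw [finrank_hyperplane (by rintro rfl; simp at hθ), finrank_euclideanSpace_fin])

instance isAddHaarMeasure_hyperplaneVolume {n : ℕ} (θ : Rn n) : (hyperplaneVolume θ).IsAddHaarMeasure := by
  unfold hyperplaneVolume; infer_instance

theorem lintegral_hyperplane {n : ℕ} {θ : Rn n} (hθ : ‖θ‖ = 1) {f : Rn n → ℝ≥0∞}
    (hf : Measurable f) :
    ∫⁻ x, f x = ∫⁻ t : ℝ, ∫⁻ z, f ((z : Rn n) + t • θ) ∂(hyperplaneVolume θ) := by
  rw [← (measurePreserving_hyperplane hθ).lintegral_comp hf, lintegral_prod_symm]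
  exact (hf.comp (measurePreserving_hyperplane hθ).measurable).aemeasurable

/-! ### Gaussian integrals. -/

theorem lintegral_exp_neg_mul_sq_norm {V : Type*} [NormedAddCommGroup V] [InnerProductSpace ℝ V]
    [FiniteDimensional ℝ V] [MeasurableSpace V] [BorelSpace V] {b : ℝ} (hb : 0 < b) :
    ∫⁻ v : V, ENNReal.ofReal (Real.exp (-b * ‖v‖ ^ 2)) =
      ENNReal.ofReal ((Real.pi / b) ^ (Module.finrank ℝ V / 2 : ℝ)) := by
  rw [← GaussianFourier.integral_rexp_neg_mul_sq_norm hb, ofReal_integral_eq_lintegral_ofReal]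
  · have := (GaussianFourier.integrable_cexp_neg_mul_sq_norm_add (V := V) (b := (b : ℂ))
      (by simpa using hb) 0 0).norm
    refine this.congr (ae_of_all _ fun v => ?_)
    simp [Complex.norm_exp, ← Complex.ofReal_pow]
  · exact ae_of_all _ fun v => (Real.exp_pos _).le

/-- Gaussian integrals of functions of one coordinate. -/
theorem lintegral_inner_mul_exp {n : ℕ} {θ : Rn n} (hθ : ‖θ‖ = 1) {f : ℝ → ℝ≥0∞}
    (hf : Measurable f) {b : ℝ} (hb : 0 < b) :
    ∫⁻ y : Rn n, f ⟪θ, y⟫ * ENNReal.ofReal (Real.exp (-b * ‖y‖ ^ 2)) =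
      (∫⁻ t : ℝ, f t * ENNReal.ofReal (Real.exp (-b * t ^ 2))) *
        ENNReal.ofReal ((Real.pi / b) ^ (((n : ℝ) - 1) / 2)) := by
  have hn : (Module.finrank ℝ (hyperplane θ) : ℝ) = (n : ℝ) - 1 := by
    rw [eq_sub_iff_add_eq]; exact_mod_cast finrank_hyperplane (by rintro rfl; simp at hθ)
  have key : ∫⁻ z, ENNReal.ofReal (Real.exp (-b * ‖z‖ ^ 2)) ∂(hyperplaneVolume θ) =
      ENNReal.ofReal ((Real.pi / b) ^ (((n : ℝ) - 1) / 2)) := by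
    rw [← hn]
    exact lintegral_exp_neg_mul_sq_norm hb
  rw [lintegral_hyperplane hθ (by fun_prop), ← lintegral_mul_const'' _ (by fun_prop)]
  refine lintegral_congr fun t => ?_
  rw [← key, ← lintegral_const_mul _ (by fun_prop)]
  refine lintegral_congr fun z => ?_
  have h1 : ⟪θ, (z : Rn n) + t • θ⟫ = t := by
    rw [inner_add_right, real_inner_comm, inner_hyperplane, inner_smul_right,
      real_inner_self_eq_norm_sq, hθ]; simp
  have h2 : ‖(z : Rn n) + t • θ‖ ^ 2 = ‖z‖ ^ 2 + t ^ 2 := by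
    rw [norm_add_sq_real, inner_smul_right, inner_hyperplane, norm_smul, hθ]
    simp
  rw [h1, h2, mul_assoc, ← ENNReal.ofReal_mul (Real.exp_pos _).le, ← Real.exp_add]
  ring_nf

theorem lintegral_abs_mul_exp_neg_mul_sq {b : ℝ} (hb : 0 < b) :
    ∫⁻ t : ℝ, ENNReal.ofReal |t| * ENNReal.ofReal (Real.exp (-b * t ^ 2)) =
      ENNReal.ofReal (1 / b) := by
  simp_rw [← ENNReal.ofReal_mul (abs_nonneg _)]
  have hint : Integrable fun t : ℝ => |t| * Real.exp (-b * t ^ 2) := by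
    refine (integrable_mul_exp_neg_mul_sq hb).norm.congr (ae_of_all _ fun t => ?_)
    simp
  rw [← ofReal_integral_eq_lintegral_ofReal hint (ae_of_all _ fun t => by positivity)]
  congr 1
  have h1 : ∫ t : ℝ, |t| * Real.exp (-b * t ^ 2) = ∫ t : ℝ, |t| * Real.exp (-b * |t| ^ 2) := by
    simp_rw [sq_abs]
  rw [h1, integral_comp_abs (f := fun t => t * Real.exp (-b * t ^ 2))]
  have h2 := integral_rpow_mul_exp_neg_mul_rpow (p := 2) (q := 1) (b := b) (by norm_num)
    (by norm_num) hb
  norm_num at h2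
  simp only [neg_mul]
  rw [h2, show b ^ (-1 : ℝ) = b⁻¹ from Real.rpow_neg_one b]
  ring

theorem lintegral_Ioi_exp_neg_mul {a : ℝ} (ha : 0 < a) :
    ∫⁻ s in Ioi (1 : ℝ), ENNReal.ofReal (Real.exp (-a * s)) =
      ENNReal.ofReal (Real.exp (-a) / a) := by
  rw [← ofReal_integral_eq_lintegral_ofReal (integrableOn_exp_mul_Ioi (by linarith) 1)
    (ae_of_all _ fun t => (Real.exp_pos _).le), integral_exp_mul_Ioi (by linarith)]
  congr 1
  rw [neg_div_neg_eq, mul_one]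

theorem lintegral_Ioi_rpow {a : ℝ} (ha : a < -1) :
    ∫⁻ s in Ioi (1 : ℝ), ENNReal.ofReal (s ^ a) = ENNReal.ofReal (-1 / (a + 1)) := by
  rw [← ofReal_integral_eq_lintegral_ofReal (integrableOn_Ioi_rpow_of_lt ha one_pos),
    integral_Ioi_rpow_of_lt ha one_pos, Real.one_rpow]
  refine (ae_restrict_mem measurableSet_Ioi).mono fun s hs => ?_
  exact Real.rpow_nonneg (zero_le_one.trans (le_of_lt hs)) _

/-- The Gaussian density `exp (-π ‖y‖ ^ 2)`. -/
def gaussianWeight {n : ℕ} (y : Rn n) : ℝ≥0∞ := ENNReal.ofReal (Real.exp (-Real.pi * ‖y‖ ^ 2))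

@[fun_prop]
theorem measurable_gaussianWeight {n : ℕ} : Measurable (gaussianWeight (n := n)) := by
  unfold gaussianWeight; fun_prop

/-- The singular factor is removed by `exp (-π ‖y‖²) / ‖y‖² = π ∫_{s > 1} exp (-π s ‖y‖²) ds`. For
unit `v` and fixed `s` the Gaussian integral splits off one coordinate and equals `s ^ (-(n + 1) /
2)`, whose integral over `s > 1` is `2 / (n - 1)`. -/
theorem lintegral_abs_inner_div_sq {n : ℕ} (hn : 2 ≤ n) (v : Rn n) :
    ∫⁻ y : Rn n, gaussianWeight y * ENNReal.ofReal (|⟪v, y⟫| / ‖y‖ ^ 2) =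
      ENNReal.ofReal (2 / ((n : ℝ) - 1)) * ENNReal.ofReal ‖v‖ := by
  have hn' : (2 : ℝ) ≤ n := by exact_mod_cast hn
  rcases eq_or_ne v 0 with rfl | hv
  · simp
  wlog hv1 : ‖v‖ = 1 generalizing v
  · have hpos : 0 < ‖v‖ := norm_pos_iff.2 hv
    have h := this (‖v‖⁻¹ • v) (by simp [hv]) (by simp [norm_smul, hpos.ne'])
    rw [norm_smul, norm_inv, norm_norm, inv_mul_cancel₀ hpos.ne', ENNReal.ofReal_one, mul_one] at h
    rw [← h, mul_comm, ← lintegral_const_mul _ (by fun_prop)]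
    refine lintegral_congr fun y => ?_
    rw [mul_left_comm, ← ENNReal.ofReal_mul hpos.le, inner_smul_left]
    congr 2
    simp [abs_mul]
    field_simp
  rw [hv1, ENNReal.ofReal_one, mul_one]
  have h1 : ∀ y : Rn n, gaussianWeight y * ENNReal.ofReal (|⟪v, y⟫| / ‖y‖ ^ 2) =
      ∫⁻ s in Ioi (1 : ℝ), ENNReal.ofReal Real.pi * (ENNReal.ofReal |⟪v, y⟫| *
        ENNReal.ofReal (Real.exp (-(Real.pi * s) * ‖y‖ ^ 2))) := by
    intro y
    rcases eq_or_ne y 0 with rfl | hy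
    · simp
    have hpos : 0 < ‖y‖ := norm_pos_iff.2 hy
    have hpi := Real.pi_pos
    rw [lintegral_const_mul _ (by fun_prop), lintegral_const_mul _ (by fun_prop)]
    have := lintegral_Ioi_exp_neg_mul (a := Real.pi * ‖y‖ ^ 2) (by positivity)
    have h2 : ∀ s : ℝ, -(Real.pi * s) * ‖y‖ ^ 2 = -(Real.pi * ‖y‖ ^ 2) * s := fun s => by ring
    simp_rw [h2]
    rw [this, gaussianWeight, ← ENNReal.ofReal_mul (by positivity),
      ← ENNReal.ofReal_mul (by positivity), ← ENNReal.ofReal_mul (by positivity), neg_mul]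
    congr 1
    field_simp
  simp_rw [h1]
  rw [lintegral_lintegral_swap (by fun_prop)]
  have h3 : ∀ s ∈ Ioi (1 : ℝ), ∫⁻ y : Rn n, ENNReal.ofReal Real.pi * (ENNReal.ofReal |⟪v, y⟫| *
      ENNReal.ofReal (Real.exp (-(Real.pi * s) * ‖y‖ ^ 2))) =
      ENNReal.ofReal (s ^ (-(((n : ℝ) + 1) / 2))) := by
    intro s hs
    have hs0 : (0 : ℝ) < s := one_pos.trans hs
    have hpi := Real.pi_pos
    rw [lintegral_const_mul _ (by fun_prop),
      lintegral_inner_mul_exp hv1 (f := fun t => ENNReal.ofReal |t|) (by fun_prop)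
        (mul_pos Real.pi_pos hs0),
      lintegral_abs_mul_exp_neg_mul_sq (mul_pos Real.pi_pos hs0),
      ← ENNReal.ofReal_mul (by positivity), ← ENNReal.ofReal_mul (by positivity)]
    congr 1
    have h4 : Real.pi / (Real.pi * s) = s⁻¹ := by field_simp
    have h5 : -(((n : ℝ) + 1) / 2) = -(((n : ℝ) - 1) / 2) + -1 := by ring
    rw [h4, Real.inv_rpow hs0.le, ← Real.rpow_neg hs0.le, h5, Real.rpow_add hs0, Real.rpow_neg_one]
    field_simp
  rw [setLIntegral_congr_fun measurableSet_Ioi h3, lintegral_Ioi_rpow (by linarith)]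
  congr 1
  have : (n : ℝ) - 1 ≠ 0 := by linarith
  have h6 : -(((n : ℝ) + 1) / 2) + 1 = -(((n : ℝ) - 1) / 2) := by ring
  rw [h6]
  field_simp

/-- Supplies the integrable majorant for reverse Fatou. It follows from the preceding formula for
the basis vectors, since `‖y‖ ≤ ∑ |y i|`. -/
theorem lintegral_gaussianWeight_div_norm_ne_top {n : ℕ} (hn : 2 ≤ n) :
    ∫⁻ y : Rn n, gaussianWeight y * ENNReal.ofReal ‖y‖⁻¹ ≠ ∞ := by
  have hle : ∀ y : Rn n, gaussianWeight y * ENNReal.ofReal ‖y‖⁻¹ ≤ ∑ i : Fin n,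
      gaussianWeight y *
        ENNReal.ofReal (|⟪EuclideanSpace.single i (1 : ℝ), y⟫| / ‖y‖ ^ 2) := by
    intro y
    rw [← Finset.mul_sum, ← ENNReal.ofReal_sum_of_nonneg (fun i _ => by positivity)]
    gcongr
    rcases eq_or_ne y 0 with rfl | hy
    · simp
    have hpos : 0 < ‖y‖ := norm_pos_iff.2 hy
    rw [← Finset.sum_div, le_div_iff₀ (by positivity), sq, ← mul_assoc,
      inv_mul_cancel₀ hpos.ne', one_mul]
    have h1 : ‖y‖ ^ 2 ≤ ∑ i, |y i| * ‖y‖ := by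
      rw [EuclideanSpace.norm_sq_eq]
      refine Finset.sum_le_sum fun i _ => ?_
      rw [sq, Real.norm_eq_abs]
      gcongr
      exact PiLp.norm_apply_le y i
    rw [← Finset.sum_mul, sq] at h1
    simpa [EuclideanSpace.inner_single_left] using le_of_mul_le_mul_right h1 hpos
  refine ne_top_of_le_ne_top ?_ (lintegral_mono hle)
  rw [lintegral_finsetSum _ fun i _ => by fun_prop]
  simp_rw [lintegral_abs_inner_div_sq hn]
  exact (ENNReal.sum_lt_top.2 fun i _ => ENNReal.mul_lt_top ENNReal.ofReal_lt_top
    ENNReal.ofReal_lt_top).ne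

/-! ### Slabs, slices and the averaged section inequality. -/

theorem indicator_const_le_of_imp {α β : Type*} {s : Set α} {t : Set β} {a : α} {b : β}
    (h : a ∈ s → b ∈ t) (C : ℝ≥0∞) : s.indicator (fun _ => C) a ≤ t.indicator (fun _ => C) b := by
  by_cases ha : a ∈ s
  · rw [indicator_of_mem ha, indicator_of_mem (h ha)]
  · simp [indicator_of_notMem ha]

theorem norm_sq_hyperplane_add {n : ℕ} {θ : Rn n} (hθ : ‖θ‖ = 1) (z : hyperplane θ) (t : ℝ) :
    ‖(z : Rn n) + t • θ‖ ^ 2 = ‖z‖ ^ 2 + t ^ 2 := by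
  rw [norm_add_sq_real, inner_smul_right, inner_hyperplane, norm_smul, hθ]
  simp

theorem norm_le_norm_hyperplane_add {n : ℕ} {θ : Rn n} (hθ : ‖θ‖ = 1) (z : hyperplane θ)
    (t : ℝ) : ‖z‖ ≤ ‖(z : Rn n) + t • θ‖ := by
  rw [← sq_le_sq₀ (norm_nonneg _) (norm_nonneg _), norm_sq_hyperplane_add hθ]
  nlinarith [sq_nonneg t]

theorem mem_closedBall_hyperplane_of_add {n : ℕ} {θ : Rn n} {R : ℝ} (hθ : ‖θ‖ = 1)
    {z : hyperplane θ} {t : ℝ} (h : (z : Rn n) + t • θ ∈ closedBall (0 : Rn n) R) :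
    z ∈ closedBall (0 : hyperplane θ) R := by
  rw [mem_closedBall_zero_iff] at h ⊢
  exact (norm_le_norm_hyperplane_add hθ z t).trans h

theorem inner_hyperplane_add {n : ℕ} {θ : Rn n} (hθ : ‖θ‖ = 1) (z : hyperplane θ) (t : ℝ) :
    ⟪(z : Rn n) + t • θ, θ⟫ = t := by
  rw [inner_add_left, inner_hyperplane, real_inner_smul_left, real_inner_self_eq_norm_sq, hθ]
  simp

/-- A cylinder of height one over the ball lies in a slightly larger ball. The point is that the
bound does not depend on `θ`. -/
theorem hyperplaneVolume_closedBall_le {n : ℕ} {θ : Rn n} (hθ : ‖θ‖ = 1) (R : ℝ) :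
    hyperplaneVolume θ (closedBall 0 R) ≤ volume (closedBall (0 : Rn n) (R + 1)) := by
  rw [← lintegral_indicator_one (μ := volume) measurableSet_closedBall, lintegral_hyperplane hθ
    (measurable_one.indicator measurableSet_closedBall)]
  calc hyperplaneVolume θ (closedBall 0 R)
      = ∫⁻ t in Icc (0 : ℝ) 1, hyperplaneVolume θ (closedBall 0 R) := by simp
    _ ≤ ∫⁻ t in Icc (0 : ℝ) 1, ∫⁻ z, (closedBall (0 : Rn n) (R + 1)).indicator 1
          ((z : Rn n) + t • θ) ∂(hyperplaneVolume θ) := by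
        refine setLIntegral_mono' measurableSet_Icc fun t ht => ?_
        rw [← lintegral_indicator_one measurableSet_closedBall]
        refine lintegral_mono fun z => indicator_const_le_of_imp (fun hz => ?_) 1
        rw [mem_closedBall_zero_iff] at hz ⊢
        refine (norm_add_le _ _).trans (add_le_add hz ?_)
        rw [norm_smul, hθ, mul_one, Real.norm_eq_abs, abs_of_nonneg ht.1]
        exact ht.2
    _ ≤ _ := setLIntegral_le_lintegral _ _

/-- The integral of `f` over the translate by `t` of the hyperplane `θ^⊥`. -/
def sliceIntegral {n : ℕ} (f : Rn n → ℝ≥0∞) (θ : Rn n) (t : ℝ) : ℝ≥0∞ :=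
  ∫⁻ z, f ((z : Rn n) + t • θ) ∂(hyperplaneVolume θ)

theorem lintegral_slab {n : ℕ} {f : Rn n → ℝ≥0∞} (hf : Measurable f) {θ : Rn n} (hθ : ‖θ‖ = 1)
    {r ε : ℝ} (hr : 0 < r) :
    ∫⁻ x in {x | |⟪x, r • θ⟫| ≤ ε}, f x = ∫⁻ t in Icc (-(ε / r)) (ε / r), sliceIntegral f θ t := by
  have hms : MeasurableSet {x : Rn n | |⟪x, r • θ⟫| ≤ ε} :=
    measurableSet_le (by fun_prop) measurable_const
  rw [← lintegral_indicator hms, ← lintegral_indicator measurableSet_Icc,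
    lintegral_hyperplane hθ (hf.indicator hms)]
  refine lintegral_congr fun t => ?_
  have h : ∀ z : hyperplane θ, (z : Rn n) + t • θ ∈ {x : Rn n | |⟪x, r • θ⟫| ≤ ε} ↔
      t ∈ Icc (-(ε / r)) (ε / r) := by
    intro z
    rw [mem_ofPred_eq, inner_smul_right, inner_hyperplane_add hθ, abs_mul, abs_of_pos hr,
      mem_Icc, ← abs_le, le_div_iff₀ hr, mul_comm]
  by_cases ht : t ∈ Icc (-(ε / r)) (ε / r)
  · rw [indicator_of_mem ht]
    exact lintegral_congr fun z => indicator_of_mem ((h z).2 ht) _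
  · rw [indicator_of_notMem ht, ← lintegral_zero]
    exact lintegral_congr fun z => indicator_of_notMem (fun hz => ht ((h z).1 hz)) _

theorem sliceIntegral_le {n : ℕ} {f : Rn n → ℝ≥0∞} {C : ℝ≥0∞} {R : ℝ}
    (hC : ∀ x, f x ≤ (closedBall (0 : Rn n) R).indicator (fun _ => C) x) {θ : Rn n}
    (hθ : ‖θ‖ = 1) (t : ℝ) :
    sliceIntegral f θ t ≤ C * volume (closedBall (0 : Rn n) (R + 1)) := by
  calc sliceIntegral f θ t
      ≤ ∫⁻ z, (closedBall (0 : hyperplane θ) R).indicator (fun _ => C) z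
          ∂(hyperplaneVolume θ) := by
        refine lintegral_mono fun z => (hC _).trans
          (indicator_const_le_of_imp (mem_closedBall_hyperplane_of_add hθ) C)
    _ = C * hyperplaneVolume θ (closedBall 0 R) :=
        lintegral_indicator_const measurableSet_closedBall _
    _ ≤ _ := by gcongr; exact hyperplaneVolume_closedBall_le hθ R

/-- Upper semicontinuity of `f` passes to its slice integrals by reverse Fatou, along a sequence of
heights tending to zero that would violate the bound. -/
theorem eventually_sliceIntegral_le {n : ℕ} {f : Rn n → ℝ≥0∞} (hf : Measurable f)
    (husc : UpperSemicontinuous f) {C : ℝ≥0∞} (hCtop : C ≠ ∞) {R : ℝ}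
    (hC : ∀ x, f x ≤ (closedBall (0 : Rn n) R).indicator (fun _ => C) x) {θ : Rn n}
    (hθ : ‖θ‖ = 1) {η : ℝ≥0∞} (hη : sliceIntegral f θ 0 < η) :
    ∀ᶠ t in 𝓝 (0 : ℝ), sliceIntegral f θ t ≤ η := by
  by_contra hcon
  obtain ⟨u, hu, hlt⟩ := exists_seq_forall_of_frequently (not_eventually.1 hcon)
  refine hη.not_ge ?_
  calc η ≤ limsup (fun k => sliceIntegral f θ (u k)) atTop :=
        le_limsup_of_frequently_le (Frequently.of_forall fun k => (not_le.1 (hlt k)).le)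
    _ ≤ ∫⁻ z, limsup (fun k => f ((z : Rn n) + u k • θ)) atTop ∂(hyperplaneVolume θ) := by
        refine limsup_lintegral_le ((closedBall (0 : hyperplane θ) R).indicator fun _ => C)
          (fun k => by fun_prop) (fun k => ae_of_all _ fun z =>
            (hC _).trans
          (indicator_const_le_of_imp (mem_closedBall_hyperplane_of_add hθ) C)) ?_
        rw [lintegral_indicator_const measurableSet_closedBall]
        exact (ENNReal.mul_lt_top hCtop.lt_top measure_closedBall_lt_top).ne
    _ ≤ sliceIntegral f θ 0 := by
        refine lintegral_mono fun z => ?_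
        have hz : Tendsto (fun k => (z : Rn n) + u k • θ) atTop (𝓝 ((z : Rn n) + (0 : ℝ) • θ)) :=
          tendsto_const_nhds.add (hu.smul_const θ)
        exact (limsup_le_limsup_of_le (f := map _ atTop) hz).trans
          (husc.upperSemicontinuousAt _).limsup_le

/-- The integral of `f` over the slab of points `x` with `|⟪x, y⟫| ≤ ε`, divided by `2 * ε`. -/
def slabAverage {n : ℕ} (f : Rn n → ℝ≥0∞) (ε : ℝ) (y : Rn n) : ℝ≥0∞ :=
  ENNReal.ofReal (2 * ε)⁻¹ * ∫⁻ x in {x | |⟪x, y⟫| ≤ ε}, f x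

theorem slabAverage_smul_le {n : ℕ} {f : Rn n → ℝ≥0∞} (hf : Measurable f) {θ : Rn n}
    (hθ : ‖θ‖ = 1) {r ε : ℝ} (hr : 0 < r) (hε : 0 < ε) {M : ℝ≥0∞}
    (hM : ∀ t ∈ Icc (-(ε / r)) (ε / r), sliceIntegral f θ t ≤ M) :
    slabAverage f ε (r • θ) ≤ ENNReal.ofReal r⁻¹ * M := by
  rw [slabAverage, lintegral_slab hf hθ hr]
  calc _ ≤ ENNReal.ofReal (2 * ε)⁻¹ * ∫⁻ t in Icc (-(ε / r)) (ε / r), M := by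
        gcongr 1
        exact setLIntegral_mono' measurableSet_Icc hM
    _ = _ := by
        rw [setLIntegral_const, Real.volume_Icc, mul_comm M, ← mul_assoc,
          ← ENNReal.ofReal_mul (by positivity)]
        congr 2
        field_simp
        ring

theorem measurable_slab {n : ℕ} (ε : ℝ) :
    MeasurableSet {p : Rn n × Rn n | |⟪p.1, p.2⟫| ≤ ε} :=
  measurableSet_le (by fun_prop) measurable_const

theorem slabAverage_eq {n : ℕ} (f : Rn n → ℝ≥0∞) (ε : ℝ) (y : Rn n) :
    slabAverage f ε y = ENNReal.ofReal (2 * ε)⁻¹ *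
      ∫⁻ x, f x * {p : Rn n × Rn n | |⟪p.1, p.2⟫| ≤ ε}.indicator 1 (x, y) := by
  rw [slabAverage, ← lintegral_indicator (measurableSet_le (by fun_prop) measurable_const)]
  congr 2 with x
  by_cases h : |⟪x, y⟫| ≤ ε <;> simp [h]

theorem measurable_slabAverage {n : ℕ} {f : Rn n → ℝ≥0∞} (hf : Measurable f) (ε : ℝ) :
    Measurable (slabAverage f ε) := by
  simp_rw [funext (slabAverage_eq f ε)]
  refine Measurable.const_mul (Measurable.lintegral_prod_left' (f := fun p : Rn n × Rn n =>
    f p.1 * {p : Rn n × Rn n | |⟪p.1, p.2⟫| ≤ ε}.indicator 1 p) ?_) _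
  exact (hf.comp measurable_fst).mul (measurable_one.indicator (measurable_slab ε))

theorem limsup_slabAverage_le {n : ℕ} {f : Rn n → ℝ≥0∞} (hf : Measurable f)
    (husc : UpperSemicontinuous f) {C : ℝ≥0∞} (hCtop : C ≠ ∞) {R : ℝ}
    (hC : ∀ x, f x ≤ (closedBall (0 : Rn n) R).indicator (fun _ => C) x) {y : Rn n}
    (hy : y ≠ 0) :
    limsup (fun k : ℕ => slabAverage f (1 / ((k : ℝ) + 1)) y) atTop ≤
      ENNReal.ofReal ‖y‖⁻¹ * sliceIntegral f (‖y‖⁻¹ • y) 0 := by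
  have hr : 0 < ‖y‖ := norm_pos_iff.2 hy
  have hθ : ‖‖y‖⁻¹ • y‖ = 1 := by simp [norm_smul, hr.ne']
  have hy' : y = ‖y‖ • ‖y‖⁻¹ • y := by rw [smul_smul, mul_inv_cancel₀ hr.ne', one_smul]
  have key : ∀ η, sliceIntegral f (‖y‖⁻¹ • y) 0 < η →
      limsup (fun k : ℕ => slabAverage f (1 / ((k : ℝ) + 1)) y) atTop ≤
        ENNReal.ofReal ‖y‖⁻¹ * η := by
    intro η hη
    refine limsup_le_of_le (by isBoundedDefault) ?_
    obtain ⟨δ, hδ, hball⟩ := Metric.eventually_nhds_iff.1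
      (eventually_sliceIntegral_le hf husc hCtop hC hθ hη)
    have ht : Tendsto (fun k : ℕ => 1 / ((k : ℝ) + 1) / ‖y‖) atTop (𝓝 0) := by
      simpa using tendsto_one_div_add_atTop_nhds_zero_nat.div_const ‖y‖
    filter_upwards [ht.eventually (gt_mem_nhds hδ)] with k hk
    nth_rewrite 1 [hy']
    refine slabAverage_smul_le hf hθ hr (by positivity) fun t ht => hball ?_
    rw [Real.dist_eq, sub_zero]
    exact (abs_le.2 ht).trans_lt hk
  have hfin : sliceIntegral f (‖y‖⁻¹ • y) 0 ≠ ∞ :=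
    ((sliceIntegral_le hC hθ 0).trans_lt
      (ENNReal.mul_lt_top hCtop.lt_top measure_closedBall_lt_top)).ne
  have hcont : Tendsto (fun η => ENNReal.ofReal ‖y‖⁻¹ * η)
      (𝓝[>] (sliceIntegral f (‖y‖⁻¹ • y) 0))
      (𝓝 (ENNReal.ofReal ‖y‖⁻¹ * sliceIntegral f (‖y‖⁻¹ • y) 0)) :=
    (ENNReal.continuous_const_mul ENNReal.ofReal_ne_top).continuousWithinAt
  have : (𝓝[>] (sliceIntegral f (‖y‖⁻¹ • y) 0)).NeBot := nhdsGT_neBot_of_exists_gt ⟨∞, hfin.lt_top⟩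
  exact ge_of_tendsto hcont (eventually_nhdsWithin_of_forall key)

/-- The slab of `y` depends only on the coordinate along `x / ‖x‖`, which ranges over an interval of
length `2ε / ‖x‖`; the one-dimensional Gaussian density is smallest at its ends. At `x = 0` the left
side vanishes because `0⁻¹ = 0`. -/
theorem le_lintegral_gaussianWeight_slab {n : ℕ} {x : Rn n} {ε : ℝ} (hε : 0 < ε) :
    ENNReal.ofReal ‖x‖⁻¹ * ENNReal.ofReal (Real.exp (-Real.pi * (ε / ‖x‖) ^ 2)) ≤
      ENNReal.ofReal (2 * ε)⁻¹ * ∫⁻ y, gaussianWeight y *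
        {p : Rn n × Rn n | |⟪p.1, p.2⟫| ≤ ε}.indicator 1 (x, y) := by
  rcases eq_or_ne x 0 with rfl | hx
  · simp
  have hr : 0 < ‖x‖ := norm_pos_iff.2 hx
  have hpi := Real.pi_pos
  have hθ : ‖‖x‖⁻¹ • x‖ = 1 := by simp [norm_smul, hr.ne']
  have h1 : ∫⁻ y, gaussianWeight y *
      {p : Rn n × Rn n | |⟪p.1, p.2⟫| ≤ ε}.indicator 1 (x, y) =
      ∫⁻ t in Icc (-(ε / ‖x‖)) (ε / ‖x‖), ENNReal.ofReal (Real.exp (-Real.pi * t ^ 2)) := by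
    have h2 := lintegral_inner_mul_exp hθ
      (f := (Icc (-(ε / ‖x‖)) (ε / ‖x‖)).indicator fun _ => 1)
      (measurable_const.indicator measurableSet_Icc) Real.pi_pos
    rw [div_self hpi.ne', Real.one_rpow, ENNReal.ofReal_one, mul_one] at h2
    rw [← lintegral_indicator measurableSet_Icc]
    convert h2 using 2
    · ext y
      rw [mul_comm, gaussianWeight]
      congr 1
      refine indicator_eq_indicator ?_ rfl
      rw [mem_ofPred_eq, mem_Icc, ← abs_le, le_div_iff₀ hr, real_inner_smul_left, abs_mul,
        abs_of_pos (inv_pos.2 hr), mul_right_comm, inv_mul_cancel₀ hr.ne', one_mul]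
    · ext t
      by_cases ht : t ∈ Icc (-(ε / ‖x‖)) (ε / ‖x‖) <;> 
        simp only [ht, indicator_of_mem, not_false_eq_true, indicator_of_notMem, one_mul,
          zero_mul]
  rw [h1]
  calc ENNReal.ofReal ‖x‖⁻¹ * ENNReal.ofReal (Real.exp (-Real.pi * (ε / ‖x‖) ^ 2))
      = ENNReal.ofReal (2 * ε)⁻¹ * ∫⁻ t in Icc (-(ε / ‖x‖)) (ε / ‖x‖),
          ENNReal.ofReal (Real.exp (-Real.pi * (ε / ‖x‖) ^ 2)) := by
        have h2 : ENNReal.ofReal ‖x‖⁻¹ =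
            ENNReal.ofReal (2 * ε)⁻¹ * ENNReal.ofReal (ε / ‖x‖ - -(ε / ‖x‖)) := by
          rw [← ENNReal.ofReal_mul (by positivity)]
          congr 1
          field_simp
          norm_num
        rw [setLIntegral_const, Real.volume_Icc, h2]
        ring
    _ ≤ _ := by
        gcongr 1
        refine setLIntegral_mono' measurableSet_Icc fun t ht => ?_
        have : t ^ 2 ≤ (ε / ‖x‖) ^ 2 := sq_le_sq' ht.1 ht.2
        gcongr ENNReal.ofReal (Real.exp ?_)
        nlinarith

/-- The set `|⟪x, y⟫| ≤ ε` is a slab in either variable. Integrating `f(x) γ(y) / (2ε)` over it in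
both orders and letting `ε → 0` gives the two sides: Fatou is applied in `x`, reverse Fatou in `y`.
-/
theorem lintegral_div_norm_le_slices {n : ℕ} (hn : 2 ≤ n) {f : Rn n → ℝ≥0∞} (hf : Measurable f)
    (husc : UpperSemicontinuous f) {C : ℝ≥0∞} (hCtop : C ≠ ∞) {R : ℝ}
    (hC : ∀ x, f x ≤ (closedBall (0 : Rn n) R).indicator (fun _ => C) x) :
    ∫⁻ x, f x * ENNReal.ofReal ‖x‖⁻¹ ≤ ∫⁻ y, gaussianWeight y *
      (ENNReal.ofReal ‖y‖⁻¹ * sliceIntegral f (‖y‖⁻¹ • y) 0) := by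
  have : Nontrivial (Fin n) := Fin.nontrivial_iff_two_le.2 hn
  have hne : ∀ᵐ y : Rn n, y ≠ 0 := compl_mem_ae_iff.2 (measure_singleton 0)
  set M := C * volume (closedBall (0 : Rn n) (R + 1)) with hM
  have hMtop : M < ∞ := ENNReal.mul_lt_top hCtop.lt_top measure_closedBall_lt_top
  let e : ℕ → ℝ := fun k => 1 / ((k : ℝ) + 1)
  have he : ∀ k, 0 < e k := fun k => by positivity
  have hswap : ∀ k, ∫⁻ x, f x * (ENNReal.ofReal (2 * e k)⁻¹ * ∫⁻ y, gaussianWeight y *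
        {p : Rn n × Rn n | |⟪p.1, p.2⟫| ≤ e k}.indicator 1 (x, y)) =
      ∫⁻ y, gaussianWeight y * slabAverage f (e k) y := by
    intro k
    have hmi : Measurable ({p : Rn n × Rn n | |⟪p.1, p.2⟫| ≤ e k}.indicator (1 : Rn n × Rn n → ℝ≥0∞)) :=
      measurable_one.indicator (measurable_slab _)
    have h1 : ∀ x, f x * (ENNReal.ofReal (2 * e k)⁻¹ * ∫⁻ y, gaussianWeight y *
        {p : Rn n × Rn n | |⟪p.1, p.2⟫| ≤ e k}.indicator 1 (x, y)) =
        ∫⁻ y, f x * (ENNReal.ofReal (2 * e k)⁻¹ * (gaussianWeight y *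
        {p : Rn n × Rn n | |⟪p.1, p.2⟫| ≤ e k}.indicator 1 (x, y))) := by
      intro x
      rw [lintegral_const_mul _ (by fun_prop), lintegral_const_mul _ (by fun_prop)]
    have h2 : ∀ y, gaussianWeight y * slabAverage f (e k) y =
        ∫⁻ x, f x * (ENNReal.ofReal (2 * e k)⁻¹ * (gaussianWeight y *
        {p : Rn n × Rn n | |⟪p.1, p.2⟫| ≤ e k}.indicator 1 (x, y))) := by
      intro y
      rw [slabAverage_eq, ← lintegral_const_mul _ (by fun_prop),
        ← lintegral_const_mul _ (by fun_prop)]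
      refine lintegral_congr fun x => ?_
      ring
    simp_rw [h1, h2]
    exact lintegral_lintegral_swap (by fun_prop)
  calc ∫⁻ x, f x * ENNReal.ofReal ‖x‖⁻¹
      ≤ ∫⁻ x, liminf (fun k => f x * (ENNReal.ofReal ‖x‖⁻¹ *
          ENNReal.ofReal (Real.exp (-Real.pi * (e k / ‖x‖) ^ 2)))) atTop := by
        refine lintegral_mono fun x => ?_
        have hx : f x ≠ ∞ := ((hC x).trans_lt ((indicator_le_self' (fun _ _ => zero_le) x).trans_lt
          hCtop.lt_top)).ne
        have ht : Tendsto (fun k => f x * (ENNReal.ofReal ‖x‖⁻¹ *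
            ENNReal.ofReal (Real.exp (-Real.pi * (e k / ‖x‖) ^ 2)))) atTop
            (𝓝 (f x * (ENNReal.ofReal ‖x‖⁻¹ *
              ENNReal.ofReal (Real.exp (-Real.pi * (0 / ‖x‖) ^ 2))))) := by
          refine ENNReal.Tendsto.const_mul (ENNReal.Tendsto.const_mul
            (ENNReal.tendsto_ofReal ?_) (Or.inr ENNReal.ofReal_ne_top)) (Or.inr hx)
          have : Continuous fun s : ℝ => Real.exp (-Real.pi * (s / ‖x‖) ^ 2) := by fun_prop
          exact (this.tendsto 0).comp tendsto_one_div_add_atTop_nhds_zero_nat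
        rw [ht.liminf_eq]
        simp
    _ ≤ liminf (fun k => ∫⁻ x, f x * (ENNReal.ofReal ‖x‖⁻¹ *
          ENNReal.ofReal (Real.exp (-Real.pi * (e k / ‖x‖) ^ 2)))) atTop :=
        lintegral_liminf_le fun k => by fun_prop
    _ ≤ liminf (fun k => ∫⁻ y, gaussianWeight y * slabAverage f (e k) y) atTop := by
        refine liminf_le_liminf (Eventually.of_forall fun k => ?_)
        rw [← hswap]
        refine lintegral_mono fun x => ?_
        gcongr f x * ?_
        exact le_lintegral_gaussianWeight_slab (he k)
    _ ≤ limsup (fun k => ∫⁻ y, gaussianWeight y * slabAverage f (e k) y) atTop :=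
        liminf_le_limsup
    _ ≤ ∫⁻ y, limsup (fun k => gaussianWeight y * slabAverage f (e k) y) atTop := by
        -- Slices are bounded by `M` uniformly in direction and height, so slab averages at `y` are
        -- at most `‖y‖⁻¹ M`, which is `γ`-integrable.
        refine limsup_lintegral_le (fun y => gaussianWeight y * ENNReal.ofReal ‖y‖⁻¹ * M)
          (fun k => measurable_gaussianWeight.mul (measurable_slabAverage hf _)) (fun k => ?_) ?_
        · filter_upwards [hne] with y hy
          have hr : 0 < ‖y‖ := norm_pos_iff.2 hy
          have hθ : ‖‖y‖⁻¹ • y‖ = 1 := by simp [norm_smul, hr.ne']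
          have hy' : y = ‖y‖ • ‖y‖⁻¹ • y := by rw [smul_smul, mul_inv_cancel₀ hr.ne', one_smul]
          rw [mul_assoc]
          gcongr
          conv_lhs => rw [hy']
          exact slabAverage_smul_le hf hθ hr (he k) fun t _ => sliceIntegral_le hC hθ t
        · rw [lintegral_mul_const _ (by fun_prop)]
          exact (ENNReal.mul_lt_top (lintegral_gaussianWeight_div_norm_ne_top hn).lt_top hMtop).ne
    _ ≤ _ := by
        refine lintegral_mono_ae ?_
        filter_upwards [hne] with y hy
        rw [ENNReal.limsup_const_mul_of_ne_top (by exact ENNReal.ofReal_ne_top)]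
        gcongr
        exact limsup_slabAverage_le hf husc hCtop hC hy

theorem upperSemicontinuous_indicator {X : Type*} [TopologicalSpace X] {K : Set X}
    {f : X → ℝ≥0∞} (hf : Continuous f) (hK : IsClosed K) :
    UpperSemicontinuous (K.indicator f) := by
  intro x c hc
  by_cases hx : x ∈ K
  · rw [indicator_of_mem hx] at hc
    filter_upwards [hf.continuousAt.eventually (gt_mem_nhds hc)] with y hy
    exact (indicator_le_self' (fun _ _ => zero_le) y).trans_lt hy
  · rw [indicator_of_notMem hx] at hc
    filter_upwards [hK.isOpen_compl.mem_nhds hx] with y hy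
    rwa [indicator_of_notMem hy]

theorem lintegral_div_norm_le_sections {n : ℕ} (hn : 2 ≤ n) {K : Set (Rn n)} (hK : IsCompact K)
    {g : Rn n → ℝ≥0} (hg : Continuous g) :
    ∫⁻ x in K, g x * ENNReal.ofReal ‖x‖⁻¹ ≤ ∫⁻ y, gaussianWeight y *
      (ENNReal.ofReal ‖y‖⁻¹ * sectionMeasure g K (‖y‖⁻¹ • y)) := by
  obtain ⟨R, hR⟩ := hK.isBounded.subset_closedBall 0
  obtain ⟨C, hC⟩ := hK.bddAbove_image hg.continuousOn
  have hgc : Continuous fun x => (g x : ℝ≥0∞) := ENNReal.continuous_coe.comp hg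
  have h := lintegral_div_norm_le_slices hn (f := K.indicator fun x => (g x : ℝ≥0∞))
    (hgc.measurable.indicator hK.measurableSet)
    (upperSemicontinuous_indicator hgc hK.isClosed) (C := C) ENNReal.coe_ne_top (R := R)
    (fun x => by
      by_cases hx : x ∈ K
      · rw [indicator_of_mem hx, indicator_of_mem (hR hx)]
        exact_mod_cast hC (mem_image_of_mem g hx)
      · rw [indicator_of_notMem hx]; exact zero_le)
  have h1 : ∀ θ : Rn n, sliceIntegral (K.indicator fun x => (g x : ℝ≥0∞)) θ 0 =
      sectionMeasure g K θ := by
    intro θ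
    rw [sliceIntegral, sectionMeasure, ← lintegral_indicator
      (s := {x : hyperplane θ | (x : Rn n) ∈ K}) (measurable_subtype_coe hK.measurableSet)]
    simp only [zero_smul, add_zero]
    rfl
  simp_rw [h1] at h
  refine le_trans (le_of_eq ?_) h
  rw [← lintegral_indicator hK.measurableSet]
  refine lintegral_congr fun x => ?_
  by_cases hx : x ∈ K <;> simp [hx]

/-! ### The `μ`-projection as an integral of directional derivatives of the gauge. -/

theorem toENNReal_liminf_le {ι : Type*} {l : Filter ι} {u : ι → EReal} {v : ι → ℝ≥0∞}
    (h : ∀ᶠ i in l, u i ≤ (v i : EReal)) : (liminf u l).toENNReal ≤ liminf v l := by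
  refine le_of_forall_lt fun c hc => ?_
  obtain ⟨d, hcd, hd⟩ := exists_between hc
  refine hcd.trans_le (le_liminf_of_le (by isBoundedDefault) ?_)
  have hd' : (d : EReal) < liminf u l := by
    by_contra hcon
    have := EReal.toENNReal_le_toENNReal (not_lt.1 hcon)
    rw [EReal.toENNReal_coe] at this
    exact hd.not_ge this
  filter_upwards [eventually_lt_of_lt_liminf hd', h] with i hi hi'
  exact_mod_cast (hi.trans_le hi').le

theorem zero_mem_segment_neg {n : ℕ} (θ : Rn n) : (0 : Rn n) ∈ segment ℝ (-θ) θ :=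
  ⟨1 / 2, 1 / 2, by norm_num, by norm_num, by norm_num, by simp⟩

theorem mem_segment_neg_iff {n : ℕ} {θ x : Rn n} :
    x ∈ segment ℝ (-θ) θ ↔ ∃ s : ℝ, |s| ≤ 1 ∧ x = s • θ := by
  constructor
  · rintro ⟨a, b, ha, hb, hab, rfl⟩
    exact ⟨b - a, abs_le.2 ⟨by linarith, by linarith⟩, by module⟩
  · rintro ⟨s, hs, rfl⟩
    rw [abs_le] at hs
    exact ⟨(1 - s) / 2, (1 + s) / 2, by linarith, by linarith, by ring, by module⟩

theorem isCompact_segment_neg {n : ℕ} (θ : Rn n) : IsCompact (segment ℝ (-θ) θ) := by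
  rw [segment_eq_image]
  exact isCompact_Icc.image (by fun_prop)

theorem subset_add_smul_segment {n : ℕ} (A : Set (Rn n)) (ε : ℝ) (θ : Rn n) :
    A ⊆ A + ε • segment ℝ (-θ) θ := fun x hx =>
  ⟨x, hx, 0, ⟨0, zero_mem_segment_neg θ, smul_zero _⟩, add_zero x⟩

/-- Passing to a sequence `e k → 0+` only increases the liminf, and makes Fatou's lemma available.
-/
theorem mixedMeasure_toENNReal_le {n : ℕ} (μ : Measure (Rn n)) [IsLocallyFiniteMeasure μ]
    {A : Set (Rn n)} (hA : IsCompact A) (θ : Rn n) {e : ℕ → ℝ} (he : Tendsto e atTop (𝓝[>] 0)) :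
    (mixedMeasure μ A (segment ℝ (-θ) θ)).toENNReal ≤
      liminf (fun k => ENNReal.ofReal (e k)⁻¹ * μ ((A + e k • segment ℝ (-θ) θ) \ A)) atTop := by
  have hμA : μ A ≠ ∞ := hA.measure_lt_top.ne
  have h1 : (mixedMeasure μ A (segment ℝ (-θ) θ)).toENNReal ≤
      liminf (fun ε : ℝ => ENNReal.ofReal ε⁻¹ * μ ((A + ε • segment ℝ (-θ) θ) \ A))
        (𝓝[>] (0 : ℝ)) := by
    refine toENNReal_liminf_le ?_
    filter_upwards [self_mem_nhdsWithin] with ε (hε : 0 < ε)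
    have h2 : ((μ (A + ε • segment ℝ (-θ) θ) : EReal) - (μ A : EReal)) ≤
        (μ ((A + ε • segment ℝ (-θ) θ) \ A) : EReal) := by
      rw [EReal.sub_le_iff_le_add (Or.inl (by simp)) (Or.inl (by simpa using hμA))]
      rw [← EReal.coe_ennreal_add, EReal.coe_ennreal_le_coe_ennreal_iff]
      refine (measure_mono fun x hx => ?_).trans (measure_union_le _ _)
      exact (em (x ∈ A)).elim Or.inr fun h => Or.inl ⟨hx, h⟩
    refine (EReal.div_le_div_right_of_nonneg (by exact_mod_cast hε.le) h2).trans ?_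
    rw [EReal.coe_ennreal_mul, EReal.coe_ennreal_ofReal, max_eq_left (by positivity),
      EReal.div_eq_inv_mul, ← EReal.coe_inv]
  exact h1.trans (liminf_le_liminf_of_le (g := map e atTop) (f := 𝓝[>] (0 : ℝ)) he
    (by isBoundedDefault) (by isBoundedDefault))

/-- The points `(x, t)` with `x` in the enlargement of `t • L` by `ε • [-θ, θ]`, but not in
`t • L`. -/
def shell {n : ℕ} (L : Set (Rn n)) (θ : Rn n) (ε : ℝ) : Set (Rn n × ℝ) :=
  {p | p.2 ∈ Ioc (0 : ℝ) 1 ∧ p.1 ∈ (p.2 • L + ε • segment ℝ (-θ) θ) \ (p.2 • L)}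

/-- Over `0 ≤ t ≤ 1`, the families of enlarged and of original dilates are continuous images of
compact sets; the shell is their difference cut down to `0 < t ≤ 1`. -/
theorem measurableSet_shell {n : ℕ} {L : Set (Rn n)} (hL : IsCompact L) (θ : Rn n) (ε : ℝ) :
    MeasurableSet (shell L θ ε) := by
  have h1 : IsCompact ((fun q : Rn n × ℝ × Rn n => (q.2.1 • q.1 + ε • q.2.2, q.2.1)) ''
      (L ×ˢ Icc (0 : ℝ) 1 ×ˢ segment ℝ (-θ) θ)) :=
    (hL.prod (isCompact_Icc.prod (isCompact_segment_neg θ))).image (by fun_prop)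
  have h2 : IsCompact ((fun q : Rn n × ℝ => (q.2 • q.1, q.2)) '' (L ×ˢ Icc (0 : ℝ) 1)) :=
    (hL.prod isCompact_Icc).image (by fun_prop)
  have h3 : MeasurableSet {p : Rn n × ℝ | p.2 ∈ Ioc (0 : ℝ) 1} :=
    measurable_snd measurableSet_Ioc
  convert (h1.measurableSet.diff h2.measurableSet).inter h3 using 1
  ext ⟨x, t⟩
  constructor
  · rintro ⟨ht, ⟨_, ⟨l, hl, rfl⟩, _, ⟨s, hs, rfl⟩, hx⟩, hxL⟩
    refine ⟨⟨⟨(l, t, s), ⟨hl, Ioc_subset_Icc_self ht, hs⟩, ?_⟩, ?_⟩, ht⟩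
    · exact Prod.ext hx rfl
    · rintro ⟨⟨l', t'⟩, ⟨hl', -⟩, heq⟩
      obtain ⟨h4, rfl⟩ := Prod.ext_iff.1 heq
      exact hxL ⟨l', hl', h4⟩
  · rintro ⟨⟨⟨⟨l, t', s⟩, ⟨hl, -, hs⟩, heq⟩, hn⟩, ht⟩
    obtain ⟨h4, rfl⟩ := Prod.ext_iff.1 heq
    refine ⟨ht, ⟨_, ⟨l, hl, rfl⟩, _, ⟨s, hs, rfl⟩, h4⟩, ?_⟩
    rintro ⟨l', hl', h5⟩
    exact hn ⟨(l', t'), ⟨hl', Ioc_subset_Icc_self ht⟩, Prod.ext h5 rfl⟩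

theorem mem_nhds_zero_of_closedBall_subset {n : ℕ} {L : Set (Rn n)}
    (hB : closedBall (0 : Rn n) 1 ⊆ L) : L ∈ 𝓝 (0 : Rn n) :=
  mem_of_superset (closedBall_mem_nhds _ one_pos) hB

theorem mem_smul_of_gauge_le {n : ℕ} {L : Set (Rn n)} (hL : IsClosed L) (hconv : Convex ℝ L)
    (hB : closedBall (0 : Rn n) 1 ⊆ L) {t : ℝ} (ht : 0 < t) {x : Rn n} (hx : gauge L x ≤ t) :
    x ∈ t • L := by
  rw [mem_smul_set_iff_inv_smul_mem₀ ht.ne', ← hL.closure_eq,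
    ← gauge_le_one_iff_mem_closure hconv (mem_nhds_zero_of_closedBall_subset hB),
    gauge_smul_of_nonneg (inv_nonneg.2 ht.le), smul_eq_mul, inv_mul_le_iff₀ ht, mul_one]
  exact hx

theorem lipschitzWith_gauge_of_closedBall_subset {n : ℕ} {L : Set (Rn n)} (hconv : Convex ℝ L)
    (hB : closedBall (0 : Rn n) 1 ⊆ L) : LipschitzWith 1 (gauge L) := by
  simpa using hconv.lipschitzWith_gauge one_pos (ball_subset_closedBall.trans hB)

/-- For `(x, t)` in the shell, `t` lies between a value of the gauge near `x` and `gauge L x`. -/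
theorem exists_gauge_le_of_mem_shell {n : ℕ} {L : Set (Rn n)} (hL : IsClosed L)
    (hconv : Convex ℝ L) (hB : closedBall (0 : Rn n) 1 ⊆ L) {θ x : Rn n} {ε t : ℝ} (hε : 0 < ε)
    (h : (x, t) ∈ shell L θ ε) :
    t < gauge L x ∧ t ≤ 1 ∧ ∃ s : ℝ, |s| ≤ ε ∧ gauge L (x + s • θ) ≤ t := by
  obtain ⟨ht, ⟨l, hl, _, ⟨s, hs, rfl⟩, hx⟩, hxL⟩ := h
  refine ⟨not_le.1 fun hle => hxL (mem_smul_of_gauge_le hL hconv hB ht.1 hle), ht.2, ?_⟩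
  obtain ⟨s, hs1, rfl⟩ := mem_segment_neg_iff.1 hs
  refine ⟨-(ε * s), ?_, ?_⟩
  · rw [abs_neg, abs_mul, abs_of_pos hε]
    exact mul_le_of_le_one_right hε.le hs1
  · have : x + -(ε * s) • θ = l := by
      rw [← show l + ε • s • θ = x from hx]; module
    rw [this]
    exact gauge_le_of_mem ht.1.le hl

theorem volume_shell_slice_le {n : ℕ} {L : Set (Rn n)} (hL : IsClosed L)
    (hconv : Convex ℝ L) (hB : closedBall (0 : Rn n) 1 ⊆ L) {θ x : Rn n} {ε c : ℝ} (hε : 0 < ε)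
    (hc : ∀ s : ℝ, |s| ≤ ε → gauge L x - ε * c ≤ gauge L (x + s • θ)) :
    ENNReal.ofReal ε⁻¹ * volume {t | (x, t) ∈ shell L θ ε} ≤ ENNReal.ofReal c := by
  have hsub : {t | (x, t) ∈ shell L θ ε} ⊆ Ico (gauge L x - ε * c) (gauge L x) := by
    intro t ht
    obtain ⟨h1, -, s, hs, h2⟩ := exists_gauge_le_of_mem_shell hL hconv hB hε ht
    exact ⟨(hc s hs).trans h2, h1⟩
  calc _ ≤ ENNReal.ofReal ε⁻¹ * ENNReal.ofReal (ε * c) := by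
        gcongr
        refine (measure_mono hsub).trans_eq ?_
        rw [Real.volume_Ico, sub_sub_cancel]
    _ = _ := by
        rw [← ENNReal.ofReal_mul (by positivity), ← mul_assoc, inv_mul_cancel₀ hε.ne', one_mul]

theorem gauge_sub_le_gauge_add {n : ℕ} {L : Set (Rn n)} (hconv : Convex ℝ L)
    (hB : closedBall (0 : Rn n) 1 ⊆ L) {θ : Rn n} (hθ : ‖θ‖ = 1) (x : Rn n) {s ε : ℝ}
    (hs : |s| ≤ ε) : gauge L x - ε ≤ gauge L (x + s • θ) := by
  have h := (lipschitzWith_gauge_of_closedBall_subset hconv hB).dist_le_mul x (x + s • θ)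
  rw [Real.dist_eq, dist_eq_norm, sub_add_cancel_left, norm_neg, norm_smul, hθ] at h
  simp only [NNReal.coe_one, one_mul, mul_one, Real.norm_eq_abs] at h
  linarith [le_abs_self (gauge L x - gauge L (x + s • θ))]

/-- For fixed `x` the heights `t` in the shell fill at most the drop of the gauge within distance
`ε` of `x` along `θ`, which is `ε |∂_θ p(x)| + o(ε)`. For `x` outside the closed set `L` the gauge
exceeds `1 ≥ t`, so the slice is empty for small `ε`. -/
theorem limsup_volume_shell_slice_le {n : ℕ} {L : Set (Rn n)} (hL : IsClosed L)
    (hconv : Convex ℝ L) (hB : closedBall (0 : Rn n) 1 ⊆ L) {θ : Rn n} (hθ : ‖θ‖ = 1)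
    {x : Rn n} (hx : DifferentiableAt ℝ (gauge L) x) {e : ℕ → ℝ} (he : ∀ k, 0 < e k)
    (he0 : Tendsto e atTop (𝓝 0)) :
    limsup (fun k => ENNReal.ofReal (e k)⁻¹ * volume {t | (x, t) ∈ shell L θ (e k)}) atTop ≤
      L.indicator (fun x => ENNReal.ofReal |fderiv ℝ (gauge L) x θ|) x := by
  by_cases hxL : x ∈ L
  · rw [indicator_of_mem hxL]
    have key : ∀ η : ℝ, 0 < η →
        limsup (fun k => ENNReal.ofReal (e k)⁻¹ * volume {t | (x, t) ∈ shell L θ (e k)}) atTop ≤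
        ENNReal.ofReal (|fderiv ℝ (gauge L) x θ| + η) := by
      intro η hη
      refine limsup_le_of_le (by isBoundedDefault) ?_
      obtain ⟨δ, hδ, hball⟩ := Metric.eventually_nhds_iff.1
        ((hasFDerivAt_iff_isLittleO_nhds_zero.1 hx.hasFDerivAt).def hη)
      filter_upwards [he0.eventually (gt_mem_nhds hδ)] with k hk
      refine volume_shell_slice_le hL hconv hB (he k) fun s hs => ?_
      have hn : ‖s • θ‖ = |s| := by rw [norm_smul, hθ, mul_one, Real.norm_eq_abs]
      have h1 := hball (y := s • θ) (by rw [dist_zero_right, hn]; exact hs.trans_lt hk)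
      rw [hn, map_smul, smul_eq_mul, Real.norm_eq_abs] at h1
      have h2 := (abs_le.1 h1).1
      have h3 : |s * fderiv ℝ (gauge L) x θ| ≤ e k * |fderiv ℝ (gauge L) x θ| := by
        rw [abs_mul]; gcongr
      have h4 : η * |s| ≤ η * e k := by gcongr
      linarith [(abs_le.1 h3).1]
    have hcont : Tendsto (fun η : ℝ => ENNReal.ofReal (|fderiv ℝ (gauge L) x θ| + η))
        (𝓝[>] 0) (𝓝 (ENNReal.ofReal (|fderiv ℝ (gauge L) x θ| + 0))) :=
      (ENNReal.continuous_ofReal.comp (by fun_prop)).continuousWithinAt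
    rw [add_zero] at hcont
    exact ge_of_tendsto hcont (eventually_nhdsWithin_of_forall key)
  · rw [indicator_of_notMem hxL]
    have h1 : 1 < gauge L x := not_le.1 fun h => hxL (by
      simpa using mem_smul_of_gauge_le hL hconv hB one_pos h)
    refine limsup_le_of_le (by isBoundedDefault) ?_
    filter_upwards [he0.eventually (gt_mem_nhds (sub_pos.2 h1))] with k hk
    have : {t | (x, t) ∈ shell L θ (e k)} = ∅ := by
      refine eq_empty_of_forall_notMem fun t ht => ?_
      obtain ⟨-, h2, s, hs, h3⟩ := exists_gauge_le_of_mem_shell hL hconv hB (he k) ht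
      linarith [gauge_sub_le_gauge_add hconv hB hθ x hs]
    simp [this]

theorem isLocallyFiniteMeasure_withDensity_continuous {n : ℕ} {g : Rn n → ℝ≥0}
    (hg : Continuous g) :
    IsLocallyFiniteMeasure ((volume : Measure (Rn n)).withDensity fun x => (g x : ℝ≥0∞)) :=
  IsLocallyFiniteMeasure.withDensity_coe hg

/-- Fubini on the shell exchanges the `μ`-measure of its sections at fixed `t` for the lengths of
its sections at fixed `x`. The gauge is Lipschitz, so Rademacher's theorem makes it differentiable
almost everywhere, and the Lipschitz bound also dominates the reverse Fatou step. -/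
theorem lintegral_mixedMeasure_le {n : ℕ} {L : Set (Rn n)} (hL : IsCompact L)
    (hconv : Convex ℝ L) (hB : closedBall (0 : Rn n) 1 ⊆ L) {g : Rn n → ℝ≥0} (hg : Continuous g)
    {θ : Rn n} (hθ : ‖θ‖ = 1) :
    ∫⁻ t in Icc (0 : ℝ) 1, (mixedMeasure (volume.withDensity fun x => (g x : ℝ≥0∞)) (t • L)
      (segment ℝ (-θ) θ)).toENNReal ≤
      ∫⁻ x in L, g x * ENNReal.ofReal |fderiv ℝ (gauge L) x θ| := by
  have := isLocallyFiniteMeasure_withDensity_continuous hg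
  have hgm : Measurable fun x => (g x : ℝ≥0∞) := (ENNReal.continuous_coe.comp hg).measurable
  set μ := (volume : Measure (Rn n)).withDensity fun x => (g x : ℝ≥0∞) with hμ
  let e : ℕ → ℝ := fun k => 1 / ((k : ℝ) + 1)
  have he : ∀ k, 0 < e k := fun k => by positivity
  have he1 : ∀ k, e k ≤ 1 := fun k => by
    rw [div_le_one (by positivity)]; linarith [(Nat.cast_nonneg k : (0 : ℝ) ≤ k)]
  have he0 : Tendsto e atTop (𝓝 0) := tendsto_one_div_add_atTop_nhds_zero_nat
  have hm := fun k => measurableSet_shell hL θ (e k)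
  have hmx : ∀ k, Measurable fun t => μ {x | (x, t) ∈ shell L θ (e k)} := fun k =>
    measurable_measure_prodMk_right (hm k)
  have hmt : ∀ k, Measurable fun x => volume {t | (x, t) ∈ shell L θ (e k)} := fun k =>
    measurable_measure_prodMk_left (hm k)
  obtain ⟨R, hR⟩ := hL.isBounded.subset_closedBall 0
  obtain ⟨C, hC⟩ := (isCompact_closedBall (0 : Rn n) (R + 1)).bddAbove_image hg.continuousOn
  have hslice : ∀ k x, ENNReal.ofReal (e k)⁻¹ * volume {t | (x, t) ∈ shell L θ (e k)} ≤
      (closedBall (0 : Rn n) (R + 1)).indicator 1 x := by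
    intro k x
    by_cases hx : x ∈ closedBall (0 : Rn n) (R + 1)
    · rw [indicator_of_mem hx, Pi.one_apply, ← ENNReal.ofReal_one]
      refine volume_shell_slice_le hL.isClosed hconv hB (he k) fun s hs => ?_
      rw [mul_one]
      exact gauge_sub_le_gauge_add hconv hB hθ x hs
    · have : {t | (x, t) ∈ shell L θ (e k)} = ∅ := by
        refine eq_empty_of_forall_notMem fun t ht => hx ?_
        obtain ⟨ht, ⟨_, ⟨l, hl, rfl⟩, _, ⟨s, hs, rfl⟩, hx⟩, -⟩ := ht
        rw [← show t • l + e k • s = x from hx]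
        obtain ⟨s, hs1, rfl⟩ := mem_segment_neg_iff.1 hs
        rw [mem_closedBall_zero_iff]
        refine (norm_add_le _ _).trans (add_le_add ?_ ?_)
        · rw [norm_smul, Real.norm_eq_abs, abs_of_pos ht.1]
          exact (mul_le_of_le_one_left (norm_nonneg _) ht.2).trans
            (mem_closedBall_zero_iff.1 (hR hl))
        · rw [norm_smul, norm_smul, hθ, mul_one, Real.norm_eq_abs, Real.norm_eq_abs,
            abs_of_pos (he k)]
          exact mul_le_one₀ (he1 k) (abs_nonneg s) hs1
      simp [this]
  calc ∫⁻ t in Icc (0 : ℝ) 1, (mixedMeasure μ (t • L) (segment ℝ (-θ) θ)).toENNReal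
      ≤ ∫⁻ t in Icc (0 : ℝ) 1,
          liminf (fun k => ENNReal.ofReal (e k)⁻¹ * μ {x | (x, t) ∈ shell L θ (e k)}) atTop := by
        -- The null value `t = 0` is dropped, since the shell only contains heights `t > 0`.
        rw [setLIntegral_congr Ioc_ae_eq_Icc.symm, setLIntegral_congr Ioc_ae_eq_Icc.symm]
        refine setLIntegral_mono' measurableSet_Ioc fun t ht => ?_
        refine (mixedMeasure_toENNReal_le μ (hL.smul t) θ (e := e)
          (tendsto_nhdsWithin_iff.2 ⟨he0, Eventually.of_forall he⟩)).trans_eq ?_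
        have h1 : ∀ k, {x | (x, t) ∈ shell L θ (e k)} =
            (t • L + e k • segment ℝ (-θ) θ) \ (t • L) := fun k => by
          ext x; exact and_iff_right ht
        simp_rw [h1]
    _ ≤ ∫⁻ t : ℝ,
          liminf (fun k => ENNReal.ofReal (e k)⁻¹ * μ {x | (x, t) ∈ shell L θ (e k)}) atTop :=
        setLIntegral_le_lintegral _ _
    _ ≤ liminf (fun k => ∫⁻ t : ℝ,
          ENNReal.ofReal (e k)⁻¹ * μ {x | (x, t) ∈ shell L θ (e k)}) atTop :=
        lintegral_liminf_le fun k => (hmx k).const_mul _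
    _ = liminf (fun k => ∫⁻ x, g x * (ENNReal.ofReal (e k)⁻¹ *
          volume {t | (x, t) ∈ shell L θ (e k)})) atTop := by
        congr 1 with k
        have h1 : ∫⁻ t, μ {x | (x, t) ∈ shell L θ (e k)} =
            ∫⁻ x, volume {t | (x, t) ∈ shell L θ (e k)} ∂μ :=
          (Measure.prod_apply_symm (hm k)).symm.trans (Measure.prod_apply (hm k))
        rw [lintegral_const_mul _ (hmx k), h1, hμ,
          lintegral_withDensity_eq_lintegral_mul _ hgm (hmt k),
          ← lintegral_const_mul _ (hgm.mul (hmt k))]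
        refine lintegral_congr fun x => ?_
        rw [Pi.mul_apply, mul_left_comm]
    _ ≤ limsup (fun k => ∫⁻ x, g x * (ENNReal.ofReal (e k)⁻¹ *
          volume {t | (x, t) ∈ shell L θ (e k)})) atTop := liminf_le_limsup
    _ ≤ ∫⁻ x, limsup (fun k => g x * (ENNReal.ofReal (e k)⁻¹ *
          volume {t | (x, t) ∈ shell L θ (e k)})) atTop := by
        refine limsup_lintegral_le ((closedBall (0 : Rn n) (R + 1)).indicator fun _ => (C : ℝ≥0∞))
          (fun k => hgm.mul ((hmt k).const_mul _))
          (fun k => ae_of_all _ fun x => ?_) ?_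
        · refine (mul_le_mul_right (hslice k x) _).trans ?_
          by_cases hx : x ∈ closedBall (0 : Rn n) (R + 1)
          · rw [indicator_of_mem hx, indicator_of_mem hx, Pi.one_apply, mul_one]
            exact_mod_cast hC (mem_image_of_mem g hx)
          · simp [indicator_of_notMem hx]
        · rw [lintegral_indicator_const measurableSet_closedBall]
          exact (ENNReal.mul_lt_top ENNReal.coe_lt_top measure_closedBall_lt_top).ne
    _ ≤ ∫⁻ x, L.indicator (fun x => g x * ENNReal.ofReal |fderiv ℝ (gauge L) x θ|) x := by
        refine lintegral_mono_ae ?_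
        filter_upwards [(lipschitzWith_gauge_of_closedBall_subset hconv hB).ae_differentiableAt]
          with x hx
        rw [ENNReal.limsup_const_mul_of_ne_top (by exact ENNReal.coe_ne_top),
          indicator_mul_right]
        gcongr
        exact limsup_volume_shell_slice_le hL.isClosed hconv hB hθ hx he he0
    _ = _ := lintegral_indicator hL.measurableSet _

/-- With `v x` the gradient of the gauge, exchanging the integrals leaves `∫ γ(y) |⟪v x, y⟫| / ‖y‖²
dy` at each `x`. The constant is `(n / 2) · 2 / (n - 1)`, and `‖v x‖ ≤ 1`. -/
theorem lintegral_muProjection_le {n : ℕ} (hn : 2 ≤ n) {L : Set (Rn n)} (hL : IsCompact L)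
    (hconv : Convex ℝ L) (hB : closedBall (0 : Rn n) 1 ⊆ L) {g : Rn n → ℝ≥0}
    (hg : Continuous g) :
    ∫⁻ y, gaussianWeight y * (ENNReal.ofReal ‖y‖⁻¹ *
      muProjection (volume.withDensity fun x => (g x : ℝ≥0∞)) L (‖y‖⁻¹ • y)) ≤
      ENNReal.ofReal ((n : ℝ) / ((n : ℝ) - 1)) *
        (volume.withDensity fun x => (g x : ℝ≥0∞)) L := by
  have hn' : (2 : ℝ) ≤ n := by exact_mod_cast hn
  have : Nontrivial (Fin n) := Fin.nontrivial_iff_two_le.2 hn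
  have hne : ∀ᵐ y : Rn n, y ≠ 0 := compl_mem_ae_iff.2 (measure_singleton 0)
  have hgm : Measurable fun x => (g x : ℝ≥0∞) := (ENNReal.continuous_coe.comp hg).measurable
  let v : Rn n → Rn n := fun x => (InnerProductSpace.toDual ℝ (Rn n)).symm (fderiv ℝ (gauge L) x)
  have hv : Measurable v :=
    (InnerProductSpace.toDual ℝ (Rn n)).symm.continuous.measurable.comp (measurable_fderiv ℝ _)
  have hvn : ∀ x, ‖v x‖ ≤ 1 := fun x => by
    rw [LinearIsometryEquiv.norm_map]
    simpa using norm_fderiv_le_of_lipschitz ℝ (lipschitzWith_gauge_of_closedBall_subset hconv hB)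
  have hvi : ∀ x y, ⟪v x, y⟫ = fderiv ℝ (gauge L) x y := fun x y =>
    InnerProductSpace.toDual_symm_apply
  calc ∫⁻ y, gaussianWeight y * (ENNReal.ofReal ‖y‖⁻¹ *
      muProjection (volume.withDensity fun x => (g x : ℝ≥0∞)) L (‖y‖⁻¹ • y))
      ≤ ∫⁻ y, ∫⁻ x in L, (n : ℝ≥0∞) / 2 * (g x * (gaussianWeight y *
          ENNReal.ofReal (|⟪v x, y⟫| / ‖y‖ ^ 2))) := by
        refine lintegral_mono_ae ?_
        filter_upwards [hne] with y hy
        have hr : 0 < ‖y‖ := norm_pos_iff.2 hy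
        have hθ : ‖‖y‖⁻¹ • y‖ = 1 := by simp [norm_smul, hr.ne']
        calc _ ≤ gaussianWeight y * (ENNReal.ofReal ‖y‖⁻¹ * ((n : ℝ≥0∞) / 2 *
              ∫⁻ x in L, g x * ENNReal.ofReal |fderiv ℝ (gauge L) x (‖y‖⁻¹ • y)|)) := by
              gcongr
              exact mul_le_mul_right (lintegral_mixedMeasure_le hL hconv hB hg hθ) _
          _ = _ := by
              simp_rw [← hvi]
              rw [← lintegral_const_mul _ (by fun_prop), ← lintegral_const_mul _ (by fun_prop),
                ← lintegral_const_mul _ (by fun_prop)]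
              refine lintegral_congr fun x => ?_
              have h1 : |⟪v x, y⟫| / ‖y‖ ^ 2 = ‖y‖⁻¹ * |⟪v x, ‖y‖⁻¹ • y⟫| := by
                rw [inner_smul_right, abs_mul, abs_of_pos (inv_pos.2 hr)]
                field_simp
              rw [h1, ENNReal.ofReal_mul (inv_nonneg.2 hr.le)]
              ring
    _ = ∫⁻ x in L, (n : ℝ≥0∞) / 2 * (g x * (ENNReal.ofReal (2 / ((n : ℝ) - 1)) *
          ENNReal.ofReal ‖v x‖)) := by
        rw [lintegral_lintegral_swap (by fun_prop)]
        refine lintegral_congr fun x => ?_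
        rw [lintegral_const_mul _ (by fun_prop), lintegral_const_mul _ (by fun_prop),
          lintegral_abs_inner_div_sq hn]
    _ ≤ ∫⁻ x in L, ENNReal.ofReal ((n : ℝ) / ((n : ℝ) - 1)) * g x := by
        refine lintegral_mono fun x => ?_
        have h1 : (n : ℝ≥0∞) / 2 = ENNReal.ofReal ((n : ℝ) / 2) := by
          rw [ENNReal.ofReal_div_of_pos two_pos, ENNReal.ofReal_natCast, ENNReal.ofReal_ofNat]
        have h2 : (n : ℝ) / ((n : ℝ) - 1) = n / 2 * (2 / ((n : ℝ) - 1)) := by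
          field_simp
        rw [h1, h2, ENNReal.ofReal_mul (p := (n : ℝ) / 2) (by positivity)]
        calc _ ≤ ENNReal.ofReal ((n : ℝ) / 2) * (g x * (ENNReal.ofReal (2 / ((n : ℝ) - 1)) * 1)) := by
              gcongr
              exact ENNReal.ofReal_le_one.2 (hvn x)
          _ = _ := by ring
    _ = _ := by
        rw [lintegral_const_mul _ hgm, withDensity_apply _ hL.measurableSet]

/-! ### John's position: a symmetric body lies in the ball of radius `√n`. -/

/-- The expression equals `1` at `δ = 0` and has derivative `R² - n > 0` there. It will be the
squared determinant of the competing ellipsoid. -/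
theorem exists_one_lt_mul_pow {n : ℕ} (hn : 1 ≤ n) {R : ℝ} (hR : (n : ℝ) < R ^ 2) :
    ∃ δ : ℝ, 0 < δ ∧ δ < 1 ∧ 1 < (1 + (R ^ 2 - 1) * δ) * (1 - δ) ^ (n - 1) := by
  have hn' : (1 : ℝ) ≤ n := by exact_mod_cast hn
  have hR2 : 0 < R ^ 2 := by linarith
  have hD : 0 < 2 * R ^ 2 * n := by positivity
  -- After Bernoulli's inequality the quadratic loss is at most `R² n δ²`; this `δ` makes it half of
  -- the linear gain `(R² - n) δ`.
  refine ⟨(R ^ 2 - n) / (2 * R ^ 2 * n), div_pos (by linarith) hD, ?_, ?_⟩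
  · rw [div_lt_one hD]; nlinarith
  set δ := (R ^ 2 - n) / (2 * R ^ 2 * n) with hδ
  have hδ0 : 0 < δ := div_pos (by linarith) hD
  have hδD : δ * (2 * R ^ 2 * n) = R ^ 2 - n := div_mul_cancel₀ _ hD.ne'
  have hδ1 : δ < 1 := by rw [hδ, div_lt_one hD]; nlinarith
  have hb := one_add_mul_le_pow (a := -δ) (by linarith) (n - 1)
  rw [Nat.cast_sub hn, Nat.cast_one, ← sub_eq_add_neg] at hb
  have hpos : 0 < 1 + (R ^ 2 - 1) * δ := by
    have : 0 ≤ (R ^ 2 - 1) * δ := mul_nonneg (by linarith) hδ0.le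
    linarith
  refine lt_of_lt_of_le ?_ (mul_le_mul_of_nonneg_left hb hpos.le)
  have h1 : (R ^ 2 - 1) * (n - 1) ≤ R ^ 2 * n := by nlinarith
  have h2 : (R ^ 2 - 1) * (n - 1) * δ ≤ R ^ 2 * n * δ := by gcongr
  have h3 : 0 < R ^ 2 - n - (R ^ 2 - 1) * (n - 1) * δ := by linarith
  nlinarith [mul_pos hδ0 h3]

/-- The linear map `x ↦ b x + (a - b) ⟪e, x⟫ e`, which for a unit vector `e` scales by `a` along
`e` and by `b` orthogonally to `e`. -/
def axisScaling {n : ℕ} (e : Rn n) (a b : ℝ) : Rn n →ₗ[ℝ] Rn n :=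
  b • LinearMap.transvection (innerₛₗ ℝ e) (((a - b) / b) • e)

theorem axisScaling_apply {n : ℕ} (e : Rn n) (a : ℝ) {b : ℝ} (hb : b ≠ 0) (x : Rn n) :
    axisScaling e a b x = b • x + ((a - b) * ⟪e, x⟫) • e := by
  simp only [axisScaling, LinearMap.smul_apply, LinearMap.transvection.apply, innerₛₗ_apply_apply,
    smul_add, smul_smul]
  congr 2
  field_simp

theorem det_axisScaling {n : ℕ} (hn : 1 ≤ n) {e : Rn n} (he : ‖e‖ = 1) (a : ℝ) {b : ℝ}
    (hb : b ≠ 0) : LinearMap.det (axisScaling e a b) = a * b ^ (n - 1) := by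
  rw [axisScaling, LinearMap.det_smul, LinearMap.transvection.det, finrank_euclideanSpace_fin]
  obtain ⟨m, rfl⟩ : ∃ m, n = m + 1 := ⟨n - 1, by omega⟩
  rw [map_smul, innerₛₗ_apply_apply, real_inner_self_eq_norm_sq, he, Nat.add_sub_cancel, pow_succ]
  simp
  field_simp
  ring

theorem inner_axisScaling_le {n : ℕ} {e : Rn n} (he : ‖e‖ = 1) {a b : ℝ} (hb : b ≠ 0)
    (w : Rn n) {z : Rn n} (hz : ‖z‖ ≤ 1) :
    ⟪w, axisScaling e a b z⟫ ≤ √(b ^ 2 * ‖w‖ ^ 2 + (a ^ 2 - b ^ 2) * ⟪w, e⟫ ^ 2) := by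
  have h1 : ⟪w, axisScaling e a b z⟫ = ⟪b • w + ((a - b) * ⟪w, e⟫) • e, z⟫ := by
    rw [axisScaling_apply e a hb]
    simp only [inner_add_left, inner_add_right, real_inner_smul_left, inner_smul_right]
    ring
  have h2 : ‖b • w + ((a - b) * ⟪w, e⟫) • e‖ ^ 2 =
      b ^ 2 * ‖w‖ ^ 2 + (a ^ 2 - b ^ 2) * ⟪w, e⟫ ^ 2 := by
    rw [norm_add_sq_real, norm_smul, norm_smul, he, real_inner_smul_left, inner_smul_right,
      mul_pow, mul_one, Real.norm_eq_abs, Real.norm_eq_abs, sq_abs, sq_abs]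
    ring
  rw [h1, ← h2, Real.sqrt_sq (norm_nonneg _)]
  exact (real_inner_le_norm _ _).trans (mul_le_of_le_one_right (norm_nonneg _) hz)

/-- A comparison of support functions. Since `a² - b² = R² δ`, the squared support function of the
ellipsoid at `w` is `(1 - δ) ‖w‖² + δ (R ⟪w, e⟫)²`, a convex combination of squared support
functions of the unit ball and of the segment `[-R e, R e]`, both contained in `K`. -/
theorem axisScaling_mem {n : ℕ} {K : Set (Rn n)} (hconv : Convex ℝ K) (hclosed : IsClosed K)
    (hsymm : IsOriginSymmetric K) (hB : closedBall (0 : Rn n) 1 ⊆ K) {e : Rn n} (he : ‖e‖ = 1)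
    {R : ℝ} (hR : R • e ∈ K) {a b δ : ℝ} (hb : b ≠ 0) (hδ0 : 0 ≤ δ) (hδ1 : δ ≤ 1)
    (ha2 : a ^ 2 = 1 + (R ^ 2 - 1) * δ) (hb2 : b ^ 2 = 1 - δ) {z : Rn n} (hz : ‖z‖ ≤ 1) :
    axisScaling e a b z ∈ K := by
  by_contra hcon
  obtain ⟨f, u, hfK, hfz⟩ := geometric_hahn_banach_closed_point hconv hclosed hcon
  obtain ⟨w, rfl⟩ := (InnerProductSpace.toDual ℝ (Rn n)).surjective f
  simp only [InnerProductSpace.toDual_apply_apply] at hfK hfz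
  have hu : 0 < u := by simpa using hfK 0 (hB (by simp))
  have hwu : ‖w‖ ≤ u := by
    rcases eq_or_ne w 0 with rfl | hw
    · simpa using hu.le
    have hpos : 0 < ‖w‖ := norm_pos_iff.2 hw
    have := hfK (‖w‖⁻¹ • w) (hB (by simp [norm_smul, hpos.ne']))
    rw [inner_smul_right, real_inner_self_eq_norm_sq, sq, ← mul_assoc, inv_mul_cancel₀ hpos.ne',
      one_mul] at this
    exact this.le
  have h1 := hfK _ hR
  have h2 := hfK (-(R • e)) (by rw [← hsymm]; simpa using hR)
  rw [inner_neg_right] at h2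
  rw [inner_smul_right] at h1 h2
  have h3 : (R * ⟪w, e⟫) ^ 2 ≤ u ^ 2 := sq_le_sq' (by linarith) h1.le
  have h4 : ‖w‖ ^ 2 ≤ u ^ 2 := by gcongr
  have h5 := inner_axisScaling_le (a := a) he hb w hz
  have h6 : b ^ 2 * ‖w‖ ^ 2 + (a ^ 2 - b ^ 2) * ⟪w, e⟫ ^ 2 ≤ u ^ 2 := by
    rw [ha2, hb2]
    have h7 : δ * (R * ⟪w, e⟫) ^ 2 ≤ δ * u ^ 2 := by gcongr
    have h8 : (1 - δ) * ‖w‖ ^ 2 ≤ (1 - δ) * u ^ 2 := by gcongr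
    nlinarith
  exact (hfz.trans_le (h5.trans ((Real.sqrt_le_sqrt h6).trans_eq (Real.sqrt_sq hu.le)))).false

/-- A point of `K` beyond radius `√n` would let the unit ball be stretched towards it and slightly
squeezed across, giving an ellipsoid in `K` of larger volume. -/
theorem IsJohnPosition.subset_closedBall_sqrt {n : ℕ} (hn : 1 ≤ n) {K : Set (Rn n)}
    (hK : IsConvexBody K) (hsymm : IsOriginSymmetric K) (hJ : IsJohnPosition K) :
    K ⊆ closedBall (0 : Rn n) (√(n : ℝ)) := by
  intro x hx
  rw [mem_closedBall_zero_iff]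
  by_contra! hlt
  have hr : 0 < ‖x‖ := (Real.sqrt_nonneg _).trans_lt hlt
  have hR : (n : ℝ) < ‖x‖ ^ 2 := (Real.sqrt_lt' hr).1 hlt
  have hn' : (1 : ℝ) ≤ n := by exact_mod_cast hn
  obtain ⟨δ, hδ0, hδ1, hδ⟩ := exists_one_lt_mul_pow hn hR
  have ha : 0 < 1 + (‖x‖ ^ 2 - 1) * δ := by
    have : 0 ≤ (‖x‖ ^ 2 - 1) * δ := mul_nonneg (by linarith) hδ0.le
    linarith
  have hb : 0 < 1 - δ := by linarith
  have he : ‖‖x‖⁻¹ • x‖ = 1 := by simp [norm_smul, hr.ne']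
  set T := axisScaling (‖x‖⁻¹ • x) (√(1 + (‖x‖ ^ 2 - 1) * δ)) (√(1 - δ)) with hT
  have hdet : 1 < LinearMap.det T := by
    rw [hT, det_axisScaling hn he _ (Real.sqrt_pos.2 hb).ne']
    refine lt_of_pow_lt_pow_left₀ 2 (by positivity) ?_
    rwa [one_pow, mul_pow, ← pow_mul, mul_comm (n - 1), pow_mul, Real.sq_sqrt ha.le,
      Real.sq_sqrt hb.le]
  have hdet0 : LinearMap.det T ≠ 0 := (one_pos.trans hdet).ne'
  have himg : (fun y => T.equivOfDetNeZero hdet0 y + 0) '' closedBall (0 : Rn n) 1 =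
      T '' closedBall (0 : Rn n) 1 := by simp only [add_zero]; rfl
  have hle := hJ.volume_le (T '' closedBall (0 : Rn n) 1)
    ⟨T.equivOfDetNeZero hdet0, 0, himg.symm⟩ (by
      rintro _ ⟨z, hz, rfl⟩
      exact axisScaling_mem hK.convex hK.isCompact.isClosed hsymm hJ.subset he (R := ‖x‖)
        (by rwa [smul_smul, mul_inv_cancel₀ hr.ne', one_smul]) (Real.sqrt_pos.2 hb).ne' hδ0.le
        hδ1.le (Real.sq_sqrt ha.le) (Real.sq_sqrt hb.le) (mem_closedBall_zero_iff.1 hz))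
  rw [Measure.addHaar_image_linearMap] at hle
  have hpos : 0 < volume (closedBall (0 : Rn n) 1) := measure_closedBall_pos _ _ one_pos
  refine hle.not_gt ?_
  conv_lhs => rw [← one_mul (volume (closedBall (0 : Rn n) 1))]
  refine ENNReal.mul_lt_mul_left hpos.ne' measure_closedBall_lt_top.ne ?_
  rw [ENNReal.one_lt_ofReal]
  exact hdet.trans_le (le_abs_self _)

/-! ### Lower bound for the integral of `‖x‖⁻¹` over a convex body. -/

theorem lintegral_Icc_zpow_neg_two {p : ℝ} (hp : 0 < p) (hp1 : p ≤ 1) :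
    ∫⁻ s in Icc p 1, ENNReal.ofReal (s ^ (-2 : ℤ)) = ENNReal.ofReal (p⁻¹ - 1) := by
  have h0 : (0 : ℝ) ∉ uIcc p 1 := by rw [uIcc_of_le hp1]; exact fun h => hp.not_ge h.1
  rw [← ofReal_integral_eq_lintegral_ofReal, integral_Icc_eq_integral_Ioc,
    ← intervalIntegral.integral_of_le hp1, integral_zpow (Or.inr ⟨by norm_num, h0⟩)]
  · congr 1
    norm_num
    ring
  · exact ContinuousOn.integrableOn_Icc (ContinuousOn.zpow₀ continuousOn_id _ fun s hs =>
      Or.inl (hp.trans_le hs.1).ne')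
  · exact (ae_restrict_mem measurableSet_Icc).mono fun s hs => zpow_nonneg (hp.le.trans hs.1) _

theorem lintegral_Ioc_pow {m : ℕ} :
    ∫⁻ s in Ioc (0 : ℝ) 1, ENNReal.ofReal (s ^ m) = ENNReal.ofReal (1 / (m + 1)) := by
  rw [← ofReal_integral_eq_lintegral_ofReal, ← intervalIntegral.integral_of_le zero_le_one,
    integral_pow]
  · simp
  · exact (continuous_pow _).integrableOn_Ioc
  · exact (ae_restrict_mem measurableSet_Ioc).mono fun t ht => pow_nonneg ht.1.le _

/-- From `K ⊆ r B` one has `‖x‖⁻¹ ≥ r⁻¹ p(x)⁻¹` with `p` the gauge of `K`. Writing `p⁻¹ = 1 + ∫_p^1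
s⁻² ds` and using `|sK| = s ^ n |K|`, the integral of `p⁻¹` over `K` is at least `(1 + 1 / (n - 1))
|K|`. -/
theorem volume_le_lintegral_div_norm {n : ℕ} (hn : 2 ≤ n) {K : Set (Rn n)} (hK : IsCompact K)
    (hconv : Convex ℝ K) (hB : closedBall (0 : Rn n) 1 ⊆ K) {r : ℝ} (hr : 0 < r)
    (hKr : K ⊆ closedBall 0 r) :
    ENNReal.ofReal ((n : ℝ) / ((n - 1) * r)) * volume K ≤
      ∫⁻ x in K, ENNReal.ofReal ‖x‖⁻¹ := by
  have hn' : (2 : ℝ) ≤ n := by exact_mod_cast hn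
  have : Nontrivial (Fin n) := Fin.nontrivial_iff_two_le.2 hn
  have hne : ∀ᵐ y : Rn n, y ≠ 0 := compl_mem_ae_iff.2 (measure_singleton 0)
  have hp : Continuous (gauge K) := (lipschitzWith_gauge_of_closedBall_subset hconv hB).continuous
  have habs : Absorbent ℝ K := absorbent_nhds_zero (mem_nhds_zero_of_closedBall_subset hB)
  let S : Set (Rn n × ℝ) := {q | gauge K q.1 ≤ q.2}
  have hS : MeasurableSet S := measurableSet_le (by fun_prop) measurable_snd
  let F : Rn n × ℝ → ℝ≥0∞ := S.indicator fun q => ENNReal.ofReal (q.2 ^ (-2 : ℤ))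
  have hz : Measurable fun s : ℝ => ENNReal.ofReal (s ^ (-2 : ℤ)) :=
    (measurable_id.pow_const _).ennreal_ofReal
  have hF : Measurable F := (hz.comp measurable_snd).indicator hS
  have hpt : ∀ᵐ x, x ∈ K → ENNReal.ofReal r⁻¹ * (1 + ∫⁻ s in Ioc (0 : ℝ) 1, F (x, s)) ≤
      ENNReal.ofReal ‖x‖⁻¹ := by
    filter_upwards [hne] with x hx hxK
    have hx0 : 0 < ‖x‖ := norm_pos_iff.2 hx
    have hle : ‖x‖ / r ≤ gauge K x := le_gauge_of_subset_closedBall habs hr.le hKr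
    have hp0 : 0 < gauge K x := (div_pos hx0 hr).trans_le hle
    have hp1 : gauge K x ≤ 1 := gauge_le_one_of_mem hxK
    have h1 : ∫⁻ s in Ioc (0 : ℝ) 1, F (x, s) = ENNReal.ofReal ((gauge K x)⁻¹ - 1) := by
      rw [← lintegral_Icc_zpow_neg_two hp0 hp1, ← lintegral_indicator measurableSet_Ioc,
        ← lintegral_indicator measurableSet_Icc]
      refine lintegral_congr fun s => ?_
      by_cases hs : s ∈ Icc (gauge K x) 1
      · rw [indicator_of_mem hs, indicator_of_mem (show s ∈ Ioc 0 1 from ⟨hp0.trans_le hs.1, hs.2⟩)]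
        exact indicator_of_mem (s := S) hs.1 _
      · rw [indicator_of_notMem hs]
        by_cases hs' : s ∈ Ioc (0 : ℝ) 1
        · rw [indicator_of_mem hs']
          exact indicator_of_notMem (s := S) (fun h => hs ⟨h, hs'.2⟩) _
        · rw [indicator_of_notMem hs']
    rw [h1, ← ENNReal.ofReal_one, ← ENNReal.ofReal_add zero_le_one
      (sub_nonneg.2 ((one_le_inv₀ hp0).2 hp1)), add_sub_cancel, ← ENNReal.ofReal_mul (by positivity),
      ← mul_inv]
    refine ENNReal.ofReal_le_ofReal (inv_anti₀ hx0 ?_)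
    rwa [div_le_iff₀ hr, mul_comm] at hle
  have hslice : ∀ s ∈ Ioc (0 : ℝ) 1, ENNReal.ofReal (s ^ (n - 2)) * volume K ≤
      ∫⁻ x in K, F (x, s) := by
    intro s hs
    have hsub : s • K ⊆ {x | gauge K x ≤ s} ∩ K := fun x hx =>
      ⟨gauge_le_of_mem hs.1.le hx, by
        obtain ⟨y, hy, rfl⟩ := hx
        exact hconv.smul_mem_of_zero_mem (hB (by simp)) hy ⟨hs.1.le, hs.2⟩⟩
    have h1 : ∀ x, F (x, s) = {x | gauge K x ≤ s}.indicator
        (fun _ => ENNReal.ofReal (s ^ (-2 : ℤ))) x := fun x => rfl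
    simp_rw [h1]
    have h2 : MeasurableSet {x | gauge K x ≤ s} := measurableSet_le hp.measurable measurable_const
    rw [lintegral_indicator_const h2, Measure.restrict_apply h2]
    calc _ = ENNReal.ofReal (s ^ (-2 : ℤ)) * volume (s • K) := by
          rw [Measure.addHaar_smul, finrank_euclideanSpace_fin, abs_of_nonneg (pow_nonneg hs.1.le _),
            ← mul_assoc, ← ENNReal.ofReal_mul (zpow_nonneg hs.1.le _)]
          congr 2
          rw [← zpow_natCast, ← zpow_natCast, ← zpow_add₀ hs.1.ne', Nat.cast_sub hn]
          congr 1
      _ ≤ _ := by gcongr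
  calc ENNReal.ofReal ((n : ℝ) / ((n - 1) * r)) * volume K
      = ENNReal.ofReal r⁻¹ * (volume K +
          ∫⁻ s in Ioc (0 : ℝ) 1, ENNReal.ofReal (s ^ (n - 2)) * volume K) := by
        rw [lintegral_mul_const _ (by fun_prop), lintegral_Ioc_pow, ← one_add_mul (α := ℝ≥0∞),
          ← mul_assoc, ← ENNReal.ofReal_one, ← ENNReal.ofReal_add zero_le_one (by positivity),
          ← ENNReal.ofReal_mul (by positivity), Nat.cast_sub hn]
        have h1 : (n : ℝ) - 1 ≠ 0 := by linarith
        have h2 : (n : ℝ) - (2 : ℕ) + 1 = n - 1 := by push_cast; ring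
        rw [h2]
        congr 2
        field_simp
        ring
    _ ≤ ENNReal.ofReal r⁻¹ * (volume K + ∫⁻ s in Ioc (0 : ℝ) 1, ∫⁻ x in K, F (x, s)) := by
        gcongr ENNReal.ofReal r⁻¹ * (volume K + ?_)
        exact setLIntegral_mono' measurableSet_Ioc hslice
    _ = ∫⁻ x in K, ENNReal.ofReal r⁻¹ * (1 + ∫⁻ s in Ioc (0 : ℝ) 1, F (x, s)) := by
        rw [lintegral_const_mul _ (by fun_prop), lintegral_add_left measurable_const,
          setLIntegral_one, lintegral_lintegral_swap (by fun_prop)]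
    _ ≤ _ := setLIntegral_mono_ae' hK.measurableSet hpt

/-! ### Projections are dominated by the Lebesgue `μ`-projection. -/

theorem volume_add_le_volume_add_Icc {F : Set ℝ} (hF : IsCompact F) (hne : F.Nonempty) {ε : ℝ}
    (hε : 0 ≤ ε) : volume F + ENNReal.ofReal (2 * ε) ≤ volume (F + Icc (-ε) ε) := by
  have hm := hF.sInf_mem hne
  have hM := hF.sSup_mem hne
  have hlow : ∀ x ∈ F, sInf F ≤ x := fun x hx => csInf_le hF.bddBelow hx
  have hupp : ∀ x ∈ F, x ≤ sSup F := fun x hx => le_csSup hF.bddAbove hx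
  have hd1 : Disjoint F (Ico (sInf F - ε) (sInf F)) :=
    Set.disjoint_left.2 fun x hx hx' => (hlow x hx).not_gt hx'.2
  have hd2 : Disjoint (F ∪ Ico (sInf F - ε) (sInf F)) (Ioc (sSup F) (sSup F + ε)) := by
    rw [Set.disjoint_left]
    rintro x (hx | hx) hx'
    · exact (hupp x hx).not_gt hx'.1
    · linarith [hx.2, hx'.1, hlow _ hM]
  calc volume F + ENNReal.ofReal (2 * ε)
      = volume (F ∪ Ico (sInf F - ε) (sInf F) ∪ Ioc (sSup F) (sSup F + ε)) := by
        rw [measure_union hd2 measurableSet_Ioc, measure_union hd1 measurableSet_Ico,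
          Real.volume_Ico, Real.volume_Ioc, add_assoc, sub_sub_cancel, add_sub_cancel_left,
          ← ENNReal.ofReal_add hε hε, two_mul]
    _ ≤ _ := by
        refine measure_mono ?_
        rintro x ((hx | hx) | hx)
        · exact ⟨x, hx, 0, ⟨by linarith, hε⟩, add_zero x⟩
        · exact ⟨sInf F, hm, x - sInf F, ⟨by linarith [hx.1], by linarith [hx.2]⟩, by simp⟩
        · exact ⟨sSup F, hM, x - sSup F, ⟨by linarith [hx.1], by linarith [hx.2]⟩, by simp⟩

theorem volume_eq_lintegral_fibre {n : ℕ} {θ : Rn n} (hθ : ‖θ‖ = 1) {A : Set (Rn n)}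
    (hA : MeasurableSet A) :
    volume A = ∫⁻ z, volume {t : ℝ | (z : Rn n) + t • θ ∈ A} ∂(hyperplaneVolume θ) := by
  have h := measurePreserving_hyperplane hθ
  rw [← h.measure_preimage hA.nullMeasurableSet, Measure.prod_apply (h.measurable hA)]
  rfl

theorem orthogonalProjectionOnto_add_smul {n : ℕ} {θ : Rn n} (z : hyperplane θ) (t : ℝ) :
    (hyperplane θ).orthogonalProjectionOnto ((z : Rn n) + t • θ) = z := by
  have h : (hyperplane θ).orthogonalProjectionOnto θ = 0 :=
    Submodule.orthogonalProjectionOnto_orthogonalComplement_singleton_eq_zero θ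
  rw [map_add, map_smul, h, smul_zero, add_zero]
  exact Submodule.orthogonalProjectionOnto_mem_subspace_eq_self z

theorem exists_eq_hyperplane_add {n : ℕ} {θ : Rn n} (x : Rn n) :
    ∃ (z : hyperplane θ) (t : ℝ), x = (z : Rn n) + t • θ := by
  obtain ⟨y, hy, z, hz, h⟩ := Submodule.exists_add_mem_mem_orthogonal (K := ℝ ∙ θ) x
  obtain ⟨t, rfl⟩ := Submodule.mem_span_singleton.1 hy
  exact ⟨⟨z, hz⟩, t, by rw [h, add_comm]⟩

theorem isCompact_fibre {n : ℕ} {θ : Rn n} (hθ : ‖θ‖ = 1) {A : Set (Rn n)} (hA : IsCompact A)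
    (z : hyperplane θ) : IsCompact {t : ℝ | (z : Rn n) + t • θ ∈ A} := by
  have h1 : IsClosed {t : ℝ | (z : Rn n) + t • θ ∈ A} :=
    hA.isClosed.preimage (f := fun t : ℝ => (z : Rn n) + t • θ) (by fun_prop)
  refine (hA.image (f := fun x => ⟪x, θ⟫) (by fun_prop)).of_isClosed_subset h1 fun t ht => ?_
  exact ⟨_, ht, inner_hyperplane_add hθ z t⟩

/-- On every line parallel to `θ` that meets `A`, adding the segment lengthens the fibre by at least
`2ε`; those lines are parametrized by the projection of `A`. -/
theorem volume_add_projectionVolume_le {n : ℕ} {θ : Rn n} (hθ : ‖θ‖ = 1) {A : Set (Rn n)}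
    (hA : IsCompact A) {ε : ℝ} (hε : 0 ≤ ε) :
    volume A + ENNReal.ofReal (2 * ε) * projectionVolume A θ ≤
      volume (A + ε • segment ℝ (-θ) θ) := by
  have hAε : IsCompact (A + ε • segment ℝ (-θ) θ) := hA.add ((isCompact_segment_neg θ).smul ε)
  have hP : MeasurableSet ((fun x => (hyperplane θ).orthogonalProjectionOnto x) '' A) :=
    (hA.image (ContinuousLinearMap.continuous _)).measurableSet
  rw [projectionVolume, ← lintegral_indicator_const hP, volume_eq_lintegral_fibre hθ
    hA.measurableSet, volume_eq_lintegral_fibre hθ hAε.measurableSet,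
    ← lintegral_add_right _ (measurable_const.indicator hP)]
  refine lintegral_mono fun z => ?_
  by_cases hz : z ∈ (fun x => (hyperplane θ).orthogonalProjectionOnto x) '' A
  · rw [indicator_of_mem hz]
    have hne : {t : ℝ | (z : Rn n) + t • θ ∈ A}.Nonempty := by
      obtain ⟨x, hx, rfl⟩ := hz
      obtain ⟨w, t, rfl⟩ := exists_eq_hyperplane_add (θ := θ) x
      refine ⟨t, ?_⟩
      simpa only [mem_ofPred_eq, orthogonalProjectionOnto_add_smul] using hx
    refine (volume_add_le_volume_add_Icc (isCompact_fibre hθ hA z) hne hε).trans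
      (measure_mono ?_)
    rintro _ ⟨t, ht, s, hs, rfl⟩
    refine ⟨_, ht, s • θ, ?_, by simp only; module⟩
    rcases hε.eq_or_lt with rfl | hε
    · have : s = 0 := le_antisymm hs.2 (by simpa using hs.1)
      exact ⟨0, zero_mem_segment_neg θ, by simp [this]⟩
    · refine ⟨(s / ε) • θ, mem_segment_neg_iff.2 ⟨s / ε, ?_, rfl⟩, ?_⟩
      · rw [abs_div, abs_of_pos hε, div_le_one hε]; exact abs_le.2 hs
      · simp only [smul_smul]; rw [mul_div_cancel₀ _ hε.ne']
  · rw [indicator_of_notMem hz, add_zero]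
    exact measure_mono fun t ht => subset_add_smul_segment A ε θ ht

theorem projectionVolume_smul {n : ℕ} {θ : Rn n} (hθ : ‖θ‖ = 1) (A : Set (Rn n)) {t : ℝ}
    (ht : 0 ≤ t) :
    projectionVolume (t • A) θ = ENNReal.ofReal (t ^ (n - 1)) * projectionVolume A θ := by
  have hfr : Module.finrank ℝ (hyperplane θ) = n - 1 := by
    rw [eq_tsub_iff_add_eq_of_le]
    · exact finrank_hyperplane (by rintro rfl; simp at hθ)
    · have := finrank_hyperplane (θ := θ) (by rintro rfl; simp at hθ)
      omega
  have h1 : (fun x => (hyperplane θ).orthogonalProjectionOnto x) '' (t • A) =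
      t • (fun x => (hyperplane θ).orthogonalProjectionOnto x) '' A :=
    image_smul_set _ _ _
  rw [projectionVolume, h1, Measure.addHaar_smul, hfr, abs_of_nonneg (by positivity)]
  rfl

theorem projectionVolume_le_mixedMeasure {n : ℕ} {θ : Rn n} (hθ : ‖θ‖ = 1) {A : Set (Rn n)}
    (hA : IsCompact A) :
    2 * projectionVolume A θ ≤ (mixedMeasure volume A (segment ℝ (-θ) θ)).toENNReal := by
  have hfin : volume A ≠ ∞ := hA.measure_lt_top.ne
  rw [← EReal.toENNReal_coe (x := 2 * projectionVolume A θ)]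
  refine EReal.toENNReal_le_toENNReal (le_liminf_of_le (by isBoundedDefault) ?_)
  filter_upwards [self_mem_nhdsWithin] with ε (hε : 0 < ε)
  rw [EReal.le_div_iff_mul_le (by exact_mod_cast hε) (EReal.coe_ne_top ε),
    EReal.le_sub_iff_add_le (Or.inl (by simp)) (Or.inl (by simpa using hfin))]
  have h := volume_add_projectionVolume_le hθ hA hε.le
  rw [ENNReal.ofReal_mul zero_le_two, ENNReal.ofReal_ofNat] at h
  have h1 : (ε : EReal) = (ENNReal.ofReal ε : EReal) := by
    rw [EReal.coe_ennreal_ofReal, max_eq_left hε.le]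
  rw [h1, ← EReal.coe_ennreal_mul, ← EReal.coe_ennreal_add, EReal.coe_ennreal_le_coe_ennreal_iff]
  refine le_trans (le_of_eq ?_) h
  ring

/-- The mixed volume of `tL` with the segment is at least `2 t ^ (n - 1) |L|θ^⊥|`, and `(n / 2) · 2
∫₀¹ t ^ (n - 1) dt = 1` explains the normalization. -/
theorem projectionVolume_le_muProjection {n : ℕ} (hn : 1 ≤ n) {θ : Rn n} (hθ : ‖θ‖ = 1)
    {L : Set (Rn n)} (hL : IsCompact L) :
    projectionVolume L θ ≤ muProjection volume L θ := by
  have hn0 : (0 : ℝ) < n := by exact_mod_cast hn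
  have h1 : ∫⁻ t in Icc (0 : ℝ) 1, ENNReal.ofReal (t ^ (n - 1)) = ENNReal.ofReal (1 / n) := by
    rw [setLIntegral_congr Ioc_ae_eq_Icc.symm, lintegral_Ioc_pow, ← Nat.cast_add_one,
      Nat.sub_add_cancel hn]
  have h2 : (n : ℝ≥0∞) / 2 * (ENNReal.ofReal (1 / n) * 2) = 1 := by
    rw [mul_comm (ENNReal.ofReal _), ← mul_assoc, ENNReal.div_mul_cancel two_ne_zero (by simp),
      ← ENNReal.ofReal_natCast, ← ENNReal.ofReal_mul hn0.le, mul_one_div_cancel hn0.ne',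
      ENNReal.ofReal_one]
  calc projectionVolume L θ
      = (n : ℝ≥0∞) / 2 * ∫⁻ t in Icc (0 : ℝ) 1, ENNReal.ofReal (t ^ (n - 1)) *
          (2 * projectionVolume L θ) := by
        rw [lintegral_mul_const _ (by fun_prop), h1, ← mul_assoc (ENNReal.ofReal _), ← mul_assoc,
          h2, one_mul]
    _ ≤ _ := by
        rw [muProjection]
        gcongr (n : ℝ≥0∞) / 2 * ?_
        refine setLIntegral_mono' measurableSet_Icc fun t ht => ?_
        rw [mul_left_comm, ← projectionVolume_smul hθ L ht.1]
        exact projectionVolume_le_mixedMeasure hθ (hL.smul t)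

end

/-! ### Conclusion. -/

theorem lintegral_gaussianWeight_mono {n : ℕ} {F G : Rn n → ℝ≥0∞}
    (h : ∀ θ ∈ sphere (0 : Rn n) 1, F θ ≤ G θ) :
    ∫⁻ y, gaussianWeight y * (ENNReal.ofReal ‖y‖⁻¹ * F (‖y‖⁻¹ • y)) ≤
      ∫⁻ y, gaussianWeight y * (ENNReal.ofReal ‖y‖⁻¹ * G (‖y‖⁻¹ • y)) := by
  refine lintegral_mono fun y => ?_
  rcases eq_or_ne y 0 with rfl | hy
  · simp
  · gcongr
    exact h _ (by simp [norm_smul, hy])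

theorem volume_le_of_sectionVolume_le_projectionVolume {n : ℕ} (hn : 1 ≤ n) {K L : Set (Rn n)}
    (hK : IsCompact K) (hKconv : Convex ℝ K) (hKB : closedBall (0 : Rn n) 1 ⊆ K)
    (hKr : K ⊆ closedBall 0 (√(n : ℝ))) (hL : IsCompact L) (hLconv : Convex ℝ L)
    (hLB : closedBall (0 : Rn n) 1 ⊆ L)
    (h : ∀ θ ∈ sphere (0 : Rn n) 1, sectionVolume K θ ≤ projectionVolume L θ) :
    volume K ≤ ENNReal.ofReal (√(n : ℝ)) * volume L := by
  -- The averaging needs `n ≥ 2`. For `n = 1` the inclusions `K ⊆ B ⊆ L` already suffice.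
  rcases hn.eq_or_lt with rfl | hn2
  · simp only [Nat.cast_one, Real.sqrt_one, ENNReal.ofReal_one, one_mul] at hKr ⊢
    exact measure_mono (hKr.trans hLB)
  have hn2 : 2 ≤ n := hn2
  have hn' : (2 : ℝ) ≤ n := by exact_mod_cast hn2
  have hs : 0 < √(n : ℝ) := Real.sqrt_pos.2 (by linarith)
  have h1 : (0 : ℝ) < n - 1 := by linarith
  have hone : (volume : Measure (Rn n)).withDensity (fun _ => ((1 : ℝ≥0) : ℝ≥0∞)) = volume := by
    simp only [ENNReal.coe_one]; exact withDensity_one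
  have hsec := lintegral_div_norm_le_sections hn2 hK (g := fun _ => 1) continuous_const
  have hproj := lintegral_muProjection_le hn2 hL hLconv hLB (g := fun _ => 1) continuous_const
  rw [hone] at hproj
  simp only [ENNReal.coe_one, one_mul] at hsec
  have hmid := lintegral_gaussianWeight_mono (F := sectionMeasure (fun _ => 1) K)
    (G := muProjection volume L) fun θ hθ => by
      refine le_trans (le_of_eq ?_) ((h θ hθ).trans
        (projectionVolume_le_muProjection hn (mem_sphere_zero_iff_norm.1 hθ) hL))
      simp [sectionMeasure, sectionVolume]
  have key := ((volume_le_lintegral_div_norm hn2 hK hKconv hKB hs hKr).trans hsec).trans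
    (hmid.trans hproj)
  calc volume K = ENNReal.ofReal ((n - 1) * √(n : ℝ) / n) *
        (ENNReal.ofReal ((n : ℝ) / ((n - 1) * √(n : ℝ))) * volume K) := by
        rw [← mul_assoc, ← ENNReal.ofReal_mul (by positivity),
          div_mul_div_cancel₀ (by positivity), div_self (by positivity), ENNReal.ofReal_one, one_mul]
    _ ≤ ENNReal.ofReal ((n - 1) * √(n : ℝ) / n) *
        (ENNReal.ofReal ((n : ℝ) / ((n : ℝ) - 1)) * volume L) := by gcongr
    _ = _ := by
        rw [← mul_assoc, ← ENNReal.ofReal_mul (by positivity)]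
        congr 2
        field_simp

theorem measure_le_of_sectionMeasure_le_muProjection {n : ℕ} (hn : 2 ≤ n) {K L : Set (Rn n)}
    (hK : IsCompact K) (hKr : K ⊆ closedBall 0 (√(n : ℝ))) (hL : IsCompact L)
    (hLconv : Convex ℝ L) (hLB : closedBall (0 : Rn n) 1 ⊆ L) {g : Rn n → ℝ≥0}
    (hg : Continuous g)
    (h : ∀ θ ∈ sphere (0 : Rn n) 1, sectionMeasure g K θ ≤
      muProjection (volume.withDensity fun x => (g x : ℝ≥0∞)) L θ) :
    volume.withDensity (fun x => (g x : ℝ≥0∞)) K ≤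
      ENNReal.ofReal (√(n : ℝ) / (1 - 1 / (n : ℝ))) *
        volume.withDensity (fun x => (g x : ℝ≥0∞)) L := by
  have hn' : (2 : ℝ) ≤ n := by exact_mod_cast hn
  have hs : 0 < √(n : ℝ) := Real.sqrt_pos.2 (by linarith)
  have h1 : (0 : ℝ) < n - 1 := by linarith
  have : Nontrivial (Fin n) := Fin.nontrivial_iff_two_le.2 hn
  have hne : ∀ᵐ y : Rn n, y ≠ 0 := compl_mem_ae_iff.2 (measure_singleton 0)
  have hgm : Measurable fun x => (g x : ℝ≥0∞) := (ENNReal.continuous_coe.comp hg).measurable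
  have key := (lintegral_div_norm_le_sections hn hK hg).trans
    ((lintegral_gaussianWeight_mono h).trans (lintegral_muProjection_le hn hL hLconv hLB hg))
  calc volume.withDensity (fun x => (g x : ℝ≥0∞)) K
      ≤ ∫⁻ x in K, ENNReal.ofReal √(n : ℝ) * (g x * ENNReal.ofReal ‖x‖⁻¹) := by
        rw [withDensity_apply _ hK.measurableSet]
        refine setLIntegral_mono_ae' hK.measurableSet ?_
        filter_upwards [hne] with x hx hxK
        rw [mul_left_comm, ← ENNReal.ofReal_mul hs.le]
        refine le_mul_of_one_le_right' ?_
        rw [ENNReal.one_le_ofReal, ← div_eq_mul_inv, one_le_div (norm_pos_iff.2 hx)]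
        exact mem_closedBall_zero_iff.1 (hKr hxK)
    _ = ENNReal.ofReal √(n : ℝ) * ∫⁻ x in K, g x * ENNReal.ofReal ‖x‖⁻¹ :=
        lintegral_const_mul _ (by fun_prop)
    _ ≤ ENNReal.ofReal √(n : ℝ) * (ENNReal.ofReal ((n : ℝ) / ((n : ℝ) - 1)) *
        volume.withDensity (fun x => (g x : ℝ≥0∞)) L) := by gcongr
    _ = _ := by
        rw [← mul_assoc, ← ENNReal.ofReal_mul hs.le]
        congr 2
        field_simp

theorem corollary1p3 (n : ℕ) (hn : 1 ≤ n) (K L : Set (Rn n))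
    (hK : IsConvexBody K) (hL : IsConvexBody L)
    (hKsymm : IsOriginSymmetric K) (hLsymm : IsOriginSymmetric L)
    (hKJohn : IsJohnPosition K) (hLJohn : IsJohnPosition L) :
    ((∀ θ ∈ sphere (0 : Rn n) 1, sectionVolume K θ ≤ projectionVolume L θ) →
      volume K ≤ ENNReal.ofReal (√(n : ℝ)) * volume L) ∧
    (2 ≤ n → ∀ (μ : Measure (Rn n)) (g : Rn n → ℝ≥0), Continuous g →
      μ = volume.withDensity (fun x => (g x : ℝ≥0∞)) →
      (∀ θ ∈ sphere (0 : Rn n) 1, sectionMeasure g K θ ≤ muProjection μ L θ) →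
      μ K ≤ ENNReal.ofReal (√(n : ℝ) / (1 - 1 / (n : ℝ))) * μ L) := by
  have hKr := hKJohn.subset_closedBall_sqrt hn hK hKsymm
  refine ⟨volume_le_of_sectionVolume_le_projectionVolume hn hK.isCompact hK.convex hKJohn.subset
    hKr hL.isCompact hL.convex hLJohn.subset, ?_⟩
  rintro hn2 μ g hg rfl h
  exact measure_le_of_sectionMeasure_le_muProjection hn2 hK.isCompact hKr hL.isCompact hL.convex
    hLJohn.subset hg h
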